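/- Let $n$ be a natural number and $k\in\mathbb R$. Let $\mathcal D_n=\{W\in M(n,\mathbb C): W=W^t,\ 1-W\bar W>0\}$ be the Siegel ball, with coordinates $w_{ij}=w_{ji}$ ($i\le j$), and put $\nabla_{ij}=\nabla_{ji}=\frac{1+\delta_{ij}}{2}\frac{\partial}{\partial w_{ij}}$. For $1\le a,b\le n$ define first order differential operators on holomorphic functions on $\mathcal D_n$ by $$K^0_{ab}=\tfrac k4\delta_{ab}+\sum_i w_{ai}\nabla_{ib},\qquad K^-_{ab}=\nabla_{ab},\qquad K^+_{ab}=\tfrac k2 w_{ab}+\sum_{c,i} w_{cb}\,w_{ai}\,\nabla_{ic}.$$ (1) These operators map holomorphic functions on $\mathcal D_n$ to holomorphic functions on $\mathcal D_n$, and on these they satisfy the commutation relations of $\mathfrak{sp}(n,\mathbb R)_{\mathbb C}$: for all $i,j,a,b$, $$[K^-_{ij},K^-_{ab}]=[K^+_{ij},K^+_{ab}]=0,\qquad 2[K^-_{ij},K^0_{ab}]=K^-_{ib}\delta_{aj}+K^-_{jb}\delta_{ai},$$ $$2[K^-_{ij},K^+_{ab}]=K^0_{aj}\delta_{bi}+K^0_{bj}\delta_{ai}+K^0_{ai}\delta_{bj}+K^0_{bi}\delta_{aj},$$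 $$2[K^+_{ij},K^0_{ab}]=-K^+_{ia}\delta_{jb}-K^+_{ja}\delta_{bi},\qquad 2[K^0_{ji},K^0_{ab}]=K^0_{jb}\delta_{ai}-K^0_{ai}\delta_{bj}.$$ (2) Suppose that $q:=\frac k2-n-1>-1$. Let $\mathcal F$ be the space of holomorphic functions $f$ on $\mathcal D_n$ with $\int_{\mathcal D_n}|f|^2\rho\,dW<\infty$, with the scalar product $$(f,g)=\Lambda'_n\int_{\mathcal D_n}\overline{f(W)}\,g(W)\,\rho(W)\,dW,\qquad \rho=\det(1-W\bar W)^{q},\qquad dW=\prod_{i\le j}d\,\mathrm{Re}\,w_{ij}\,d\,\mathrm{Im}\,w_{ij},$$ where $\Lambda'_n=J_n(q)^{-1}$ and $J_n(p)=2^n\pi^{n(n+1)/2}\prod_{i=1}^n\frac{\Gamma(2p+2i)}{\Gamma(2p+n+i+1)}$. Regard each operator $T$ above as an unbounded operator in $\mathcal F$ with domain $\{f\in\mathcal F: Tf\in\mathcal F\}$. Then for all $a,b$ the adjoints with respect to this scalar product are $$(K^+_{ab})^\dagger=K^-_{ba}=K^-_{ab},\qquad (K^0_{ab})^\dagger=K^0_{ba}.$$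 Here $T^\dagger=S$ means: for $g,h\in\mathcal F$, one has $(Tf,g)=(f,h)$ for all $f$ in the domain of $T$ if and only if $h=Sg$. In particular $(Tf,g)=(f,Sg)$ for all $f$ in the domain of $T$ and all $g$ in the domain of $S$. -/

import Mathlib

namespace SiegelBall

open scoped ComplexOrder

noncomputable section

/-- The complex vector space of symmetric `n × n` matrices in its linear coordinates: one complex
coordinate `w s(i,j)` for every unordered pair of indices, i.e. for every `i ≤ j`. Its Lebesgue
measure `volume` is the product over `i ≤ j` of the measures `dRe w_ij dIm w_ij`. -/
abbrev Coord (n : ℕ) : Type := Sym2 (Fin n) → ℂ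

/-- The symmetric matrix `W` with entries `w_ij = w_ji`. -/
def mat {n : ℕ} (w : Coord n) : Matrix (Fin n) (Fin n) ℂ := Matrix.of fun i j => w s(i, j)

/-- `1 - W W̄`, where `W̄` is the entrywise complex conjugate. -/
def gap {n : ℕ} (w : Coord n) : Matrix (Fin n) (Fin n) ℂ :=
  1 - mat w * (mat w).map (starRingEnd ℂ)

/-- The Siegel ball: symmetric matrices `W` with `1 - W W̄ > 0`. -/
def ball (n : ℕ) : Set (Coord n) := {w | (gap w).PosDef}

/-- Holomorphic functions on the Siegel ball. Functions are defined on the ambient space;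
their values outside the ball are never used. -/
def IsHol {n : ℕ} (f : Coord n → ℂ) : Prop := AnalyticOnNhd ℂ f (ball n)

/-- Operators on functions, with pointwise addition and scalar multiplication. -/
abbrev Op (n : ℕ) : Type := (Coord n → ℂ) → (Coord n → ℂ)

/-- Kronecker's delta. -/
def δ {n : ℕ} (i j : Fin n) : ℂ := if i = j then 1 else 0

/-- The partial derivative `∂/∂w_ij = ∂/∂w_ji` in the coordinates `w_ab`, `a ≤ b`. -/
def pderiv {n : ℕ} (i j : Fin n) : Op n := fun f w => fderiv ℂ f w (Pi.single s(i, j) 1)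

/-- `∇_ij = χ_ij ∂/∂w_ij` with `χ_ij = (1 + δ_ij) / 2`. -/
def nabla {n : ℕ} (i j : Fin n) : Op n := fun f w => (1 + δ i j) / 2 * pderiv i j f w

/-- `K⁰_kl = (κ_k / 4) δ_kl + ∑_i w_ki ∇_il`. -/
def Kzero {n : ℕ} (κ : Fin n → ℝ) (k l : Fin n) : Op n := fun f w =>
  (κ k : ℂ) / 4 * δ k l * f w + ∑ i, mat w k i * nabla i l f w

/-- `K⁻_kl = ∇_kl`. -/
def Kminus {n : ℕ} (k l : Fin n) : Op n := nabla k l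

/-- `K⁺_kl = ((κ_k + κ_l) / 4) w_kl + ∑_{a,i} w_al w_ki ∇_ia`. -/
def Kplus {n : ℕ} (κ : Fin n → ℝ) (k l : Fin n) : Op n := fun f w =>
  ((κ k : ℂ) + κ l) / 4 * mat w k l * f w + ∑ a, ∑ i, mat w a l * mat w k i * nabla i a f w

/-- The commutator `A ∘ B - B ∘ A`. -/
def opComm {n : ℕ} (A B : Op n) : Op n := fun f => A (B f) - B (A f)

/-- `A` maps holomorphic functions on the ball to holomorphic functions on the ball. -/
def PreservesHol {n : ℕ} (A : Op n) : Prop := ∀ f : Coord n → ℂ, IsHol f → IsHol (A f)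

/-- `A` and `B` agree as operators on the holomorphic functions on the ball. -/
def HolEq {n : ℕ} (A B : Op n) : Prop :=
  ∀ f : Coord n → ℂ, IsHol f → Set.EqOn (A f) (B f) (ball n)

/-- The exponent `q = k/2 - n - 1`. -/
def expo (n : ℕ) (k : ℝ) : ℝ := k / 2 - n - 1

/-- The weight `ρ(W) = det (1 - W W̄) ^ (k/2 - n - 1)`; the determinant is real and positive on
the ball. -/
def weight {n : ℕ} (k : ℝ) (w : Coord n) : ℝ := (gap w).det.re ^ expo n k

/-- `J_n(p) = 2^n π^(n(n+1)/2) ∏_{i=1}^n Γ(2p+2i) / Γ(2p+n+i+1)`. -/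
def huaJ (n : ℕ) (p : ℝ) : ℝ :=
  2 ^ n * Real.pi ^ (n * (n + 1) / 2) *
    ∏ i ∈ Finset.Icc 1 n, Real.Gamma (2 * p + 2 * i) / Real.Gamma (2 * p + n + i + 1)

/-- The scalar product `J_n(q)⁻¹ ∫ conj f · g · ρ dW` over the ball, antilinear in the first
argument. -/
def innerProd {n : ℕ} (k : ℝ) (f g : Coord n → ℂ) : ℂ :=
  (((huaJ n (expo n k))⁻¹ : ℝ) : ℂ) *
    ∫ w in ball n, starRingEnd ℂ (f w) * g w * (weight k w : ℂ)

/-- The Hilbert space: holomorphic functions on the ball that are square integrable with respect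
to `ρ dW`. -/
def Bergman (n : ℕ) (k : ℝ) : Set (Coord n → ℂ) :=
  {f | IsHol f ∧
    MeasureTheory.IntegrableOn (fun w => ‖f w‖ ^ 2 * weight k w) (ball n) MeasureTheory.volume}

/-- The maximal domain of `T` in the Hilbert space. -/
def maxDomain {n : ℕ} (k : ℝ) (T : Op n) : Set (Coord n → ℂ) :=
  {f | f ∈ Bergman n k ∧ T f ∈ Bergman n k}

/-- `T† = S` as unbounded operators in the Hilbert space, each with its maximal domain: the graph
of the Hilbert space adjoint of `T`, i.e. the set of pairs `(g, h)` with `(T f, g) = (f, h)` for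
all `f` in the domain of `T`, is the graph of `S`. In particular `(T f, g) = (f, S g)` for all `f`
in the domain of `T` and `g` in the domain of `S`, and (case `g = 0`) only `0` is orthogonal to
the domain of `T`. -/
def HasAdjoint {n : ℕ} (k : ℝ) (T S : Op n) : Prop :=
  ∀ g ∈ Bergman n k, ∀ h ∈ Bergman n k,
    (∀ f ∈ maxDomain k T, innerProd k (T f) g = innerProd k f h) ↔ Set.EqOn h (S g) (ball n)

end

end SiegelBall

open SiegelBall

/-! The operators `K⁻`, `K⁰`, `K⁺` are first order differential operators
`f ↦ α f + df(X)` whose vector fields `X` have polynomial coefficients: `X(W)` is `e_a ⊙ e_b`,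
`(W e_a) ⊙ e_b` and `(W e_a) ⊙ (W e_b)` respectively, where `⊙` is the symmetrised product of two
vectors, a symmetric matrix (`symProd`). The commutator of two such operators is again one
(`opComm_diffOp`), by symmetry of the second derivative, so that the commutation relations are
identities between polynomial vector fields.

For the adjoints, write `D = det (1 - W W̄)`, so that `ρ = D ^ q`. Truncating the weight to
`F_ε(D)`, supported where `D ≥ ε`, makes Stokes' theorem applicable without any boundary term. Let
`X` and `Y` be the fields of `T` and `S`. The difference between `conj (T f) g` and `conj f (S g)`
contributes the derivative of `D` along `Y - X̄`, which by Jacobi's formula is `m D` up to sign,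
with a bounded function `m`: that field is tangent to the boundary. The zeroth order terms of the
operators are such that what remains is the error `conj f g m (q F_ε - D F_ε')`, in which
`q F_ε - D F_ε'` is bounded by a multiple of `ρ` and tends to `0` pointwise. Dominated convergence
gives `(T f, g) = (f, S g)` for all `f` in the domain of `T` and `g` in the domain of `S`
(`innerProd_Kplus`, `innerProd_Kzero`).

For the converse, suppose that `(T f, g) = (f, h)` on the domain of `T`. For holomorphic `u` and
`r < 1` put `u_r(W) = u(r W)`. By Cauchy's formula on circles and the invariance of the measure
under `W ↦ e^{iθ} W`, dilation is symmetric: `(u_r, v) = (u, v_r)` (`innerProd_dil`). As `T` and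
`S` are homogeneous for dilations and dilated functions are bounded, hence in the Hilbert
space `F`, the dilate of `S g - h` is orthogonal to itself, so `h = S g`.

Bounded holomorphic functions lie in `F` because `ρ` is integrable for `q > -1`
(`integrableOn_weight`). For `q < 0` this is shown by slicing in the last diagonal entry `z` of `W`:
there `D = c (R² - |z - z₀|²)`, where `c` is the determinant belonging to the upper left corner of
`W` and `R ≤ 1`, so integration over `z` bounds the integral by that of `c ^ q` over the remaining
entries, and induction on the size of the corner finishes the argument. -/

namespace SiegelBall

open scoped ComplexOrder ENNReal
open Matrix MeasureTheory Filter Topology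

/-! ### Geometry of the Siegel ball -/

/-- The operator on the Euclidean space `ℂⁿ` given by the symmetric matrix `mat w`. -/
noncomputable def opr {n : ℕ} :
    Coord n →ₗ[ℂ] (EuclideanSpace ℂ (Fin n) →L[ℂ] EuclideanSpace ℂ (Fin n)) where
  toFun w := toEuclideanCLM (n := Fin n) (𝕜 := ℂ) (mat w)
  map_add' v w := by
    rw [← map_add]; rfl
  map_smul' c w := by
    rw [RingHom.id_apply, ← map_smul]; rfl

lemma mat_symm {n : ℕ} (w : Coord n) (i j : Fin n) : mat w i j = mat w j i := by
  simp [mat, Sym2.eq_swap]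

lemma map_conj_mat {n : ℕ} (w : Coord n) : (mat w).map (starRingEnd ℂ) = (mat w)ᴴ := by
  ext i j
  simp [mat_symm w i j]

lemma gap_eq {n : ℕ} (w : Coord n) : gap w = 1 - mat w * (mat w)ᴴ := by
  rw [gap, map_conj_mat]

lemma gap_isHermitian {n : ℕ} (w : Coord n) : (gap w).IsHermitian := by
  simp [gap_eq, Matrix.IsHermitian]

lemma gap_quadratic_form {n : ℕ} (w : Coord n) (x : EuclideanSpace ℂ (Fin n)) :
    star x.ofLp ⬝ᵥ (gap w *ᵥ x.ofLp) = ((‖x‖ ^ 2 - ‖star (opr w) x‖ ^ 2 : ℝ) : ℂ) := by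
  have key : ∀ y : EuclideanSpace ℂ (Fin n), star y.ofLp ⬝ᵥ y.ofLp = ((‖y‖ ^ 2 : ℝ) : ℂ) := by
    intro y
    rw [EuclideanSpace.norm_sq_eq, dotProduct]
    push_cast
    refine Finset.sum_congr rfl fun i _ => ?_
    rw [Pi.star_apply, RCLike.star_def, ← Complex.normSq_eq_conj_mul_self,
      Complex.normSq_eq_norm_sq]
    push_cast; rfl
  have h : (star (opr w) x).ofLp = (mat w)ᴴ *ᵥ x.ofLp := by
    have : star (opr w) = toEuclideanCLM (n := Fin n) (𝕜 := ℂ) (mat w)ᴴ := by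
      rw [← star_eq_conjTranspose, map_star]; rfl
    rw [this]; rfl
  rw [gap_eq, sub_mulVec, one_mulVec, dotProduct_sub, Complex.ofReal_sub, ← key, ← key, h,
    ← mulVec_mulVec, dotProduct_mulVec, star_mulVec, conjTranspose_conjTranspose]

lemma norm_star_opr {n : ℕ} (w : Coord n) : ‖star (opr w)‖ = ‖opr w‖ := by
  rw [ContinuousLinearMap.star_eq_adjoint, LinearIsometryEquiv.norm_map]

lemma gap_posSemidef {n : ℕ} {w : Coord n} (hw : ‖opr w‖ ≤ 1) : (gap w).PosSemidef := by
  refine .of_dotProduct_mulVec_nonneg (gap_isHermitian w) fun x => ?_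
  have := gap_quadratic_form w (WithLp.toLp 2 x)
  rw [WithLp.ofLp_toLp] at this
  rw [this]
  have h := (star (opr w)).le_opNorm (WithLp.toLp 2 x)
  rw [norm_star_opr] at h
  have h2 : ‖star (opr w) (WithLp.toLp 2 x)‖ ≤ ‖WithLp.toLp 2 x‖ :=
    h.trans (mul_le_of_le_one_left (norm_nonneg _) hw)
  have h3 := pow_le_pow_left₀ (norm_nonneg _) h2 2
  exact_mod_cast sub_nonneg.2 h3

/-- The Siegel ball is the open unit ball for the operator norm. -/
lemma mem_ball_iff {n : ℕ} {w : Coord n} : w ∈ ball n ↔ ‖opr w‖ < 1 := by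
  constructor
  · intro hw
    change (gap w).PosDef at hw
    rw [← norm_star_opr]
    rcases subsingleton_or_nontrivial (EuclideanSpace ℂ (Fin n)) with hs | hs
    · rw [Subsingleton.elim (star (opr w)) 0]; simp
    have hne : (Metric.sphere (0 : EuclideanSpace ℂ (Fin n)) 1).Nonempty :=
      NormedSpace.sphere_nonempty.2 zero_le_one
    obtain ⟨x, hx, hmax⟩ := (isCompact_sphere (0 : EuclideanSpace ℂ (Fin n)) 1).exists_isMaxOn hne
      (star (opr w)).continuous.norm.continuousOn
    rw [mem_sphere_zero_iff_norm] at hx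
    have hle : ‖star (opr w)‖ ≤ ‖star (opr w) x‖ := by
      refine ContinuousLinearMap.opNorm_le_of_unit_norm (norm_nonneg _) fun y hy => ?_
      exact hmax (mem_sphere_zero_iff_norm.2 hy)
    have hx0 : x.ofLp ≠ 0 := by
      intro h
      have : x = 0 := by ext i; simp [h]
      simp [this] at hx
    have hpos := hw.dotProduct_mulVec_pos hx0
    rw [gap_quadratic_form, hx] at hpos
    have hpos' : 0 < (1 : ℝ) ^ 2 - ‖star (opr w) x‖ ^ 2 := by exact_mod_cast hpos
    have : ‖star (opr w) x‖ < 1 := by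
      nlinarith [norm_nonneg (star (opr w) x)]
    exact hle.trans_lt this
  · intro hw
    refine .of_dotProduct_mulVec_pos (gap_isHermitian w) fun x hx => ?_
    have := gap_quadratic_form w (WithLp.toLp 2 x)
    rw [WithLp.ofLp_toLp] at this
    rw [this]
    have hx0 : 0 < ‖WithLp.toLp 2 x‖ := by
      rw [norm_pos_iff]; intro h; apply hx
      have := congrArg WithLp.ofLp h
      simpa using this
    have h := (star (opr w)).le_opNorm (WithLp.toLp 2 x)
    rw [norm_star_opr] at h
    have h2 : ‖star (opr w) (WithLp.toLp 2 x)‖ < ‖WithLp.toLp 2 x‖ :=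
      h.trans_lt (mul_lt_of_lt_one_left hx0 hw)
    have h3 := pow_lt_pow_left₀ h2 (norm_nonneg _) two_ne_zero
    exact_mod_cast sub_pos.2 h3

lemma mem_ball_of_det_ne_zero {n : ℕ} {w : Coord n} (hw : ‖opr w‖ ≤ 1) (hd : (gap w).det ≠ 0) :
    w ∈ ball n :=
  (gap_posSemidef hw).posDef_iff_det_ne_zero.2 hd

lemma continuous_opr {n : ℕ} : Continuous (opr : Coord n → _) :=
  LinearMap.continuous_of_finiteDimensional _

lemma isOpen_ball {n : ℕ} : IsOpen (ball n) := by
  have : ball n = {w | ‖opr w‖ < 1} := Set.ext fun w => mem_ball_iff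
  rw [this]
  exact isOpen_lt continuous_opr.norm continuous_const

lemma norm_apply_le_opr {n : ℕ} (w : Coord n) (p : Sym2 (Fin n)) : ‖w p‖ ≤ ‖opr w‖ := by
  induction p using Sym2.ind with
  | _ i j =>
    have h := (opr w).le_opNorm (EuclideanSpace.single j 1)
    have h2 : ((opr w) (EuclideanSpace.single j 1)).ofLp i = w s(i, j) := by
      change (mat w *ᵥ (Pi.single j 1)) i = _
      simp [mat]
    have h3 := PiLp.norm_apply_le ((opr w) (EuclideanSpace.single j 1)) i
    rw [h2] at h3
    simpa using h3.trans h

lemma norm_le_opr {n : ℕ} (w : Coord n) : ‖w‖ ≤ ‖opr w‖ :=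
  (pi_norm_le_iff_of_nonneg (norm_nonneg _)).2 (norm_apply_le_opr w)

lemma isCompact_opr_le {n : ℕ} (r : ℝ) : IsCompact {w : Coord n | ‖opr w‖ ≤ r} := by
  refine Metric.isCompact_of_isClosed_isBounded
    (isClosed_le continuous_opr.norm continuous_const) ?_
  refine (Metric.isBounded_closedBall (x := (0 : Coord n)) (r := r)).subset fun w hw => ?_
  rw [mem_closedBall_zero_iff]
  exact (norm_le_opr w).trans hw

lemma smul_mem_ball {n : ℕ} {w : Coord n} {c : ℂ} (hc : ‖c‖ ≤ 1) (hw : w ∈ ball n) :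
    c • w ∈ ball n := by
  rw [mem_ball_iff] at *
  rw [map_smul, norm_smul]
  exact (mul_le_of_le_one_left (norm_nonneg _) hc).trans_lt hw

lemma norm_apply_le_one {n : ℕ} {w : Coord n} (hw : w ∈ ball n) (p : Sym2 (Fin n)) : ‖w p‖ ≤ 1 :=
  (norm_apply_le_opr w p).trans (mem_ball_iff.1 hw).le

lemma det_gap_eq_re {n : ℕ} (w : Coord n) : (gap w).det = ((gap w).det.re : ℂ) := by
  have h : star (gap w).det = (gap w).det := by
    rw [← det_conjTranspose, gap_isHermitian w]
  exact (Complex.conj_eq_iff_re.1 h).symm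

lemma det_gap_pos {n : ℕ} {w : Coord n} (hw : w ∈ ball n) : 0 < (gap w).det.re := by
  have h := PosDef.det_pos (show (gap w).PosDef from hw)
  exact (Complex.lt_def.1 h).1

lemma continuous_mat {n : ℕ} : Continuous (mat : Coord n → _) :=
  continuous_pi fun _ => continuous_pi fun _ => continuous_apply _

lemma continuous_gap {n : ℕ} : Continuous (gap : Coord n → _) := by
  have : (gap : Coord n → _) = fun w => 1 - mat w * (mat w)ᴴ := funext gap_eq
  rw [this]
  exact continuous_const.sub (continuous_mat.matrix_mul continuous_mat.matrix_conjTranspose)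

lemma continuous_det_gap {n : ℕ} : Continuous fun w : Coord n => (gap w).det.re :=
  Complex.continuous_re.comp continuous_gap.matrix_det

lemma isCompact_superlevel {n : ℕ} {ε : ℝ} :
    IsCompact {w : Coord n | ‖opr w‖ ≤ 1 ∧ ε ≤ (gap w).det.re} :=
  (isCompact_opr_le 1).inter_right (isClosed_le continuous_const continuous_det_gap)

lemma superlevel_subset_ball {n : ℕ} {ε : ℝ} (hε : 0 < ε) :
    {w : Coord n | ‖opr w‖ ≤ 1 ∧ ε ≤ (gap w).det.re} ⊆ ball n := by
  rintro w ⟨h1, h2⟩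
  refine mem_ball_of_det_ne_zero h1 fun h => ?_
  rw [h] at h2
  simp at h2
  linarith

lemma gap_smul {n : ℕ} {c : ℂ} (hc : ‖c‖ = 1) (w : Coord n) : gap (c • w) = gap w := by
  have : mat (c • w) = c • mat w := rfl
  rw [gap_eq, gap_eq, this, conjTranspose_smul, smul_mul_smul_comm]
  have : c * star c = 1 := by
    rw [RCLike.star_def, Complex.mul_conj, Complex.normSq_eq_norm_sq, hc]; simp
  rw [this, one_smul]

lemma smul_mem_ball_iff {n : ℕ} {w : Coord n} {c : ℂ} (hc : ‖c‖ = 1) :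
    c • w ∈ ball n ↔ w ∈ ball n := by
  change (gap (c • w)).PosDef ↔ (gap w).PosDef
  rw [gap_smul hc]

/-! ### The operators as first order differential operators with polynomial coefficients -/

/-- The symmetrised product `u ⊙ v`: the symmetric matrix with entries `(u_p v_q + u_q v_p) / 2`. -/
noncomputable def symProd {n : ℕ} : (Fin n → ℂ) →ₗ[ℂ] (Fin n → ℂ) →ₗ[ℂ] Coord n :=
  LinearMap.mk₂ ℂ
    (fun u v => Sym2.lift ⟨fun p q => (u p * v q + u q * v p) / 2, fun p q => by ring⟩)
    (fun u u' v => by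
      ext p; induction p using Sym2.ind with | _ p q => simp; ring)
    (fun c u v => by
      ext p; induction p using Sym2.ind with | _ p q => simp; ring)
    (fun u v v' => by
      ext p; induction p using Sym2.ind with | _ p q => simp; ring)
    (fun c u v => by
      ext p; induction p using Sym2.ind with | _ p q => simp; ring)

lemma mat_symProd {n : ℕ} (u v : Fin n → ℂ) (p q : Fin n) :
    mat (symProd u v) p q = (u p * v q + u q * v p) / 2 := rfl

lemma coord_ext {n : ℕ} {v w : Coord n} (h : ∀ p q, mat v p q = mat w p q) : v = w := by
  ext p
  induction p using Sym2.ind with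
  | _ p q => exact h p q

lemma mat_add {n : ℕ} (v w : Coord n) : mat (v + w) = mat v + mat w := rfl

lemma mat_sub {n : ℕ} (v w : Coord n) : mat (v - w) = mat v - mat w := rfl

lemma mat_smul {n : ℕ} (c : ℂ) (w : Coord n) : mat (c • w) = c • mat w := rfl

lemma mat_neg {n : ℕ} (w : Coord n) : mat (-w) = -mat w := rfl

lemma mat_zero {n : ℕ} : mat (0 : Coord n) = 0 := rfl

lemma δ_comm {n : ℕ} (i j : Fin n) : δ i j = δ j i := by
  simp [δ, eq_comm]

lemma sum_mul_δ {n : ℕ} (u : Fin n → ℂ) (j : Fin n) : ∑ i, u i * δ i j = u j := by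
  simp [δ]

lemma sum_smul_δ {n : ℕ} (u : Fin n → ℂ) : ∑ i, u i • (δ i : Fin n → ℂ) = u := by
  ext j
  simpa using sum_mul_δ u j

lemma nabla_eq_fderiv {n : ℕ} (i j : Fin n) (f : Coord n → ℂ) (w : Coord n) :
    nabla i j f w = fderiv ℂ f w (symProd (δ i) (δ j)) := by
  have : symProd (δ i) (δ j) = ((1 + δ i j) / 2) • (Pi.single s(i, j) 1 : Coord n) := by
    refine coord_ext fun p q => ?_
    rw [mat_symProd, mat_smul]
    simp only [mat, Matrix.smul_apply, of_apply, Pi.single_apply, Sym2.eq_iff, δ, smul_eq_mul]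
    grind
  rw [this, map_smul]
  rfl

/-- The first order operator `f ↦ α f + X f` with potential `α` and vector field `X`. -/
noncomputable def diffOp {n : ℕ} (α : Coord n → ℂ) (X : Coord n → Coord n) : Op n :=
  fun f w => α w * f w + fderiv ℂ f w (X w)

lemma Kminus_eq_diffOp {n : ℕ} (a b : Fin n) :
    Kminus a b = diffOp (fun _ => 0) (fun _ => symProd (δ a) (δ b)) := by
  funext f w
  simp [Kminus, diffOp, nabla_eq_fderiv]

lemma Kzero_eq_diffOp {n : ℕ} (k : ℝ) (a b : Fin n) :
    Kzero (fun _ => k) a b =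
      diffOp (fun _ => (k : ℂ) / 4 * δ a b) (fun w => symProd (mat w a) (δ b)) := by
  funext f w
  simp only [Kzero, diffOp, nabla_eq_fderiv]
  conv_rhs => rw [← sum_smul_δ (mat w a)]
  simp [map_sum]

lemma Kplus_eq_diffOp {n : ℕ} (k : ℝ) (a b : Fin n) :
    Kplus (fun _ => k) a b =
      diffOp (fun w => (k : ℂ) / 2 * mat w a b) (fun w => symProd (mat w a) (mat w b)) := by
  funext f w
  simp only [Kplus, diffOp, nabla_eq_fderiv]
  have hsum : symProd (mat w a) (mat w b) =
      symProd (∑ i, mat w a i • δ i) (∑ i, mat w b i • δ i) := by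
    rw [sum_smul_δ, sum_smul_δ]
  rw [hsum]
  simp only [map_sum, LinearMap.sum_apply, map_smul, LinearMap.smul_apply, smul_eq_mul]
  have h : ∀ c i, mat w c b * mat w a i = mat w b c * mat w a i := fun c i => by
    rw [mat_symm w c b]
  simp only [h, Finset.mul_sum, mul_assoc]
  ring_nf

lemma differentiableAt_of_isHol {n : ℕ} {f : Coord n → ℂ} (hf : IsHol f) {w : Coord n}
    (hw : w ∈ ball n) : DifferentiableAt ℂ f w := (hf w hw).differentiableAt

lemma isHol_diffOp {n : ℕ} {α : Coord n → ℂ} {X : Coord n → Coord n}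
    (hα : AnalyticOnNhd ℂ α (ball n)) (hX : AnalyticOnNhd ℂ X (ball n)) :
    PreservesHol (diffOp α X) := by
  intro f hf
  refine (hα.mul hf).add ?_
  intro w hw
  exact ((ContinuousLinearMap.id ℂ (Coord n →L[ℂ] ℂ)).analyticAt_bilinear _).comp
    ((hf.fderiv w hw).prod (hX w hw))

/-- The second derivatives cancel in a commutator of first order operators. -/
lemma opComm_diffOp {n : ℕ} {α β : Coord n → ℂ} {X Y : Coord n → Coord n}
    {α' β' : Coord n →L[ℂ] ℂ} {X' Y' : Coord n →L[ℂ] Coord n} {w : Coord n} (hw : w ∈ ball n)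
    (hα : HasFDerivAt α α' w) (hβ : HasFDerivAt β β' w)
    (hX : HasFDerivAt X X' w) (hY : HasFDerivAt Y Y' w) {f : Coord n → ℂ} (hf : IsHol f) :
    opComm (diffOp α X) (diffOp β Y) f w =
      (β' (X w) - α' (Y w)) * f w + fderiv ℂ f w (Y' (X w) - X' (Y w)) := by
  have hf1 : HasFDerivAt f (fderiv ℂ f w) w := (differentiableAt_of_isHol hf hw).hasFDerivAt
  have hf2 : HasFDerivAt (fderiv ℂ f) (fderiv ℂ (fderiv ℂ f) w) w :=
    (hf.fderiv w hw).differentiableAt.hasFDerivAt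
  have hsymm : fderiv ℂ (fderiv ℂ f) w (X w) (Y w) = fderiv ℂ (fderiv ℂ f) w (Y w) (X w) := by
    have : IsSymmSndFDerivAt ℂ f w :=
      (hf w hw).contDiffAt.isSymmSndFDerivAt (n := ⊤) (by simp)
    exact this _ _
  have h1 : HasFDerivAt (diffOp β Y f) _ w := (hβ.mul hf1).add (hf2.clm_apply hY)
  have h2 : HasFDerivAt (diffOp α X f) _ w := (hα.mul hf1).add (hf2.clm_apply hX)
  change α w * diffOp β Y f w + fderiv ℂ (diffOp β Y f) w (X w) -
    (β w * diffOp α X f w + fderiv ℂ (diffOp α X f) w (Y w)) = _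
  rw [h1.fderiv, h2.fderiv]
  simp only [diffOp, _root_.add_apply, _root_.smul_apply, smul_eq_mul,
    ContinuousLinearMap.comp_apply, ContinuousLinearMap.flip_apply, map_sub]
  rw [hsymm]
  ring

/-- The linear map sending a symmetric matrix to its `a`-th row. -/
noncomputable def rowCLM {n : ℕ} (a : Fin n) : Coord n →L[ℂ] (Fin n → ℂ) :=
  ContinuousLinearMap.pi fun p => ContinuousLinearMap.proj s(a, p)

/-- The linear map sending a symmetric matrix to its `(a, b)` entry. -/
noncomputable def entryCLM {n : ℕ} (a b : Fin n) : Coord n →L[ℂ] ℂ :=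
  ContinuousLinearMap.proj s(a, b)

lemma analyticOnNhd_bilinear {E F G H : Type*} [NormedAddCommGroup E] [NormedSpace ℂ E]
    [NormedAddCommGroup F] [NormedSpace ℂ F] [NormedAddCommGroup G] [NormedSpace ℂ G]
    [NormedAddCommGroup H] [NormedSpace ℂ H] (B : E →L[ℂ] F →L[ℂ] G) {u : H → E} {v : H → F}
    {s : Set H} (hu : AnalyticOnNhd ℂ u s) (hv : AnalyticOnNhd ℂ v s) :
    AnalyticOnNhd ℂ (fun w => B (u w) (v w)) s := fun w hw =>
  (B.analyticAt_bilinear (u w, v w)).comp_of_eq ((hu w hw).prod (hv w hw)) rfl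

lemma preservesHol_Kminus {n : ℕ} (a b : Fin n) : PreservesHol (Kminus a b) := by
  rw [Kminus_eq_diffOp]
  exact isHol_diffOp analyticOnNhd_const analyticOnNhd_const

lemma preservesHol_Kzero {n : ℕ} (k : ℝ) (a b : Fin n) :
    PreservesHol (Kzero (fun _ => k) a b) := by
  rw [Kzero_eq_diffOp]
  exact isHol_diffOp analyticOnNhd_const
    (analyticOnNhd_bilinear symProd.toContinuousBilinearMap ((rowCLM a).analyticOnNhd _)
      analyticOnNhd_const)

lemma preservesHol_Kplus {n : ℕ} (k : ℝ) (a b : Fin n) :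
    PreservesHol (Kplus (fun _ => k) a b) := by
  rw [Kplus_eq_diffOp]
  exact isHol_diffOp (analyticOnNhd_const.mul ((entryCLM a b).analyticOnNhd _))
    (analyticOnNhd_bilinear symProd.toContinuousBilinearMap ((rowCLM a).analyticOnNhd _)
      ((rowCLM b).analyticOnNhd _))

lemma opComm_Kminus_Kminus {n : ℕ} (i j a b : Fin n) :
    HolEq (opComm (Kminus i j) (Kminus a b)) 0 := by
  intro f hf w hw
  rw [Kminus_eq_diffOp, Kminus_eq_diffOp, opComm_diffOp hw (hasFDerivAt_const _ _)
    (hasFDerivAt_const _ _) (hasFDerivAt_const _ _) (hasFDerivAt_const _ _) hf]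
  simp

lemma hasFDerivAt_Kzero_field {n : ℕ} (a b : Fin n) (w : Coord n) :
    ∃ L : Coord n →L[ℂ] Coord n,
      HasFDerivAt (fun w : Coord n => symProd (mat w a) (δ b)) L w ∧
        ∀ V, L V = symProd (mat V a) (δ b) :=
  ⟨((symProd.toContinuousBilinearMap.flip (δ b)).comp (rowCLM a)),
    ((symProd.toContinuousBilinearMap.flip (δ b)).comp (rowCLM a)).hasFDerivAt, fun _ => rfl⟩

lemma hasFDerivAt_Kplus_field {n : ℕ} (a b : Fin n) (w : Coord n) :
    ∃ L : Coord n →L[ℂ] Coord n,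
      HasFDerivAt (fun w : Coord n => symProd (mat w a) (mat w b)) L w ∧
        ∀ V, L V = symProd (mat w a) (mat V b) + symProd (mat V a) (mat w b) :=
  ⟨_, symProd.toContinuousBilinearMap.hasFDerivAt_of_bilinear
    ((rowCLM a).hasFDerivAt (x := w)) ((rowCLM b).hasFDerivAt (x := w)), fun _ => rfl⟩

lemma entryCLM_apply {n : ℕ} (a b : Fin n) (w : Coord n) : entryCLM a b w = mat w a b := rfl

lemma hasFDerivAt_Kplus_potential {n : ℕ} (k : ℝ) (a b : Fin n) (w : Coord n) :
    HasFDerivAt (fun w : Coord n => (k : ℂ) / 2 * mat w a b) (((k : ℂ) / 2) • entryCLM a b) w :=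
  ((entryCLM a b).hasFDerivAt (x := w)).const_mul _

lemma opComm_Kplus_Kplus {n : ℕ} (k : ℝ) (i j a b : Fin n) :
    HolEq (opComm (Kplus (fun _ => k) i j) (Kplus (fun _ => k) a b)) 0 := by
  intro f hf w hw
  obtain ⟨X', hX, hX'⟩ := hasFDerivAt_Kplus_field i j w
  obtain ⟨Y', hY, hY'⟩ := hasFDerivAt_Kplus_field a b w
  rw [Kplus_eq_diffOp, Kplus_eq_diffOp, opComm_diffOp hw (hasFDerivAt_Kplus_potential _ _ _ _)
    (hasFDerivAt_Kplus_potential _ _ _ _) hX hY hf]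
  have h1 := mat_symm w i a
  have h2 := mat_symm w i b
  have h3 := mat_symm w j a
  have h4 := mat_symm w j b
  have hV : Y' (symProd (mat w i) (mat w j)) - X' (symProd (mat w a) (mat w b)) = 0 := by
    refine coord_ext fun p q => ?_
    simp only [hX', hY', mat_add, mat_sub, mat_zero, Matrix.add_apply, Matrix.sub_apply,
      Matrix.zero_apply, mat_symProd]
    rw [h1, h2, h3, h4]
    ring
  rw [hV, map_zero, add_zero]
  simp only [Pi.zero_apply, _root_.smul_apply, entryCLM_apply, mat_symProd, smul_eq_mul]
  rw [h1, h2, h3, h4]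
  ring

lemma opComm_Kminus_Kzero {n : ℕ} (k : ℝ) (i j a b : Fin n) :
    HolEq ((2 : ℂ) • opComm (Kminus i j) (Kzero (fun _ => k) a b))
        (δ a j • Kminus i b + δ a i • Kminus j b) := by
  intro f hf w hw
  obtain ⟨Y', hY, hY'⟩ := hasFDerivAt_Kzero_field a b w
  simp only [Pi.smul_apply, Pi.add_apply, smul_eq_mul]
  rw [Kminus_eq_diffOp, Kminus_eq_diffOp, Kminus_eq_diffOp, Kzero_eq_diffOp,
    opComm_diffOp hw (hasFDerivAt_const _ _) (hasFDerivAt_const _ _) (hasFDerivAt_const _ _) hY hf]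
  have hV : (2 : ℂ) • Y' (symProd (δ i) (δ j)) =
      δ a j • symProd (δ i) (δ b) + δ a i • symProd (δ j) (δ b) := by
    refine coord_ext fun p q => ?_
    simp only [hY', mat_add, mat_smul, Matrix.add_apply, Matrix.smul_apply, smul_eq_mul,
      mat_symProd]
    rw [δ_comm i a, δ_comm j a]
    ring
  have hV' := congrArg (fderiv ℂ f w) hV
  simp only [map_add, map_smul, smul_eq_mul] at hV'
  simp only [diffOp, _root_.zero_apply, sub_self, zero_mul, zero_add, sub_zero, hV']

lemma opComm_Kminus_Kplus {n : ℕ} (k : ℝ) (i j a b : Fin n) :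
    HolEq ((2 : ℂ) • opComm (Kminus i j) (Kplus (fun _ => k) a b))
        (δ b i • Kzero (fun _ => k) a j + δ a i • Kzero (fun _ => k) b j +
          δ b j • Kzero (fun _ => k) a i + δ a j • Kzero (fun _ => k) b i) := by
  intro f hf w hw
  obtain ⟨Y', hY, hY'⟩ := hasFDerivAt_Kplus_field a b w
  simp only [Pi.smul_apply, Pi.add_apply, smul_eq_mul]
  rw [Kminus_eq_diffOp, Kplus_eq_diffOp, Kzero_eq_diffOp, Kzero_eq_diffOp, Kzero_eq_diffOp,
    Kzero_eq_diffOp, opComm_diffOp hw (hasFDerivAt_const _ _)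
    (hasFDerivAt_Kplus_potential _ _ _ _) (hasFDerivAt_const _ _) hY hf]
  have hV : (2 : ℂ) • Y' (symProd (δ i) (δ j)) =
      δ b i • symProd (mat w a) (δ j) + δ a i • symProd (mat w b) (δ j) +
        δ b j • symProd (mat w a) (δ i) + δ a j • symProd (mat w b) (δ i) := by
    refine coord_ext fun p q => ?_
    simp only [hY', mat_add, mat_smul, Matrix.add_apply, Matrix.smul_apply, smul_eq_mul,
      mat_symProd]
    rw [δ_comm i a, δ_comm j a, δ_comm i b, δ_comm j b]
    ring
  have hV' := congrArg (fderiv ℂ f w) hV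
  simp only [map_add, map_smul, smul_eq_mul] at hV'
  simp only [diffOp, _root_.zero_apply, _root_.smul_apply, entryCLM_apply, mat_symProd, smul_eq_mul,
    sub_zero, mul_add, hV']
  rw [δ_comm i a, δ_comm j a, δ_comm i b, δ_comm j b]
  ring

lemma opComm_Kplus_Kzero {n : ℕ} (k : ℝ) (i j a b : Fin n) :
    HolEq ((2 : ℂ) • opComm (Kplus (fun _ => k) i j) (Kzero (fun _ => k) a b))
        (-(δ j b • Kplus (fun _ => k) i a) - δ b i • Kplus (fun _ => k) j a) := by
  intro f hf w hw
  obtain ⟨X', hX, hX'⟩ := hasFDerivAt_Kplus_field i j w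
  obtain ⟨Y', hY, hY'⟩ := hasFDerivAt_Kzero_field a b w
  simp only [Pi.smul_apply, Pi.sub_apply, Pi.neg_apply, smul_eq_mul]
  rw [Kplus_eq_diffOp, Kplus_eq_diffOp, Kplus_eq_diffOp, Kzero_eq_diffOp,
    opComm_diffOp hw (hasFDerivAt_Kplus_potential _ _ _ _) (hasFDerivAt_const _ _) hX hY hf]
  have hV : (2 : ℂ) • (Y' (symProd (mat w i) (mat w j)) - X' (symProd (mat w a) (δ b))) =
      -(δ j b • symProd (mat w i) (mat w a)) - δ b i • symProd (mat w j) (mat w a) := by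
    refine coord_ext fun p q => ?_
    simp only [hX', hY', mat_add, mat_sub, mat_neg, mat_smul, Matrix.add_apply, Matrix.sub_apply,
      Matrix.neg_apply, Matrix.smul_apply, smul_eq_mul, mat_symProd]
    rw [δ_comm b j, mat_symm w i a, mat_symm w j a]
    ring
  have hV' := congrArg (fderiv ℂ f w) hV
  simp only [map_sub, map_neg, map_smul, smul_eq_mul] at hV'
  simp only [diffOp, _root_.zero_apply, _root_.smul_apply, entryCLM_apply, mat_symProd, smul_eq_mul,
    zero_sub, mul_add, map_sub, hV']
  rw [δ_comm b j, mat_symm w i a, mat_symm w j a]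
  ring

lemma opComm_Kzero_Kzero {n : ℕ} (k : ℝ) (i j a b : Fin n) :
    HolEq ((2 : ℂ) • opComm (Kzero (fun _ => k) j i) (Kzero (fun _ => k) a b))
        (δ a i • Kzero (fun _ => k) j b - δ b j • Kzero (fun _ => k) a i) := by
  intro f hf w hw
  obtain ⟨X', hX, hX'⟩ := hasFDerivAt_Kzero_field j i w
  obtain ⟨Y', hY, hY'⟩ := hasFDerivAt_Kzero_field a b w
  simp only [Pi.smul_apply, Pi.sub_apply, smul_eq_mul]
  rw [Kzero_eq_diffOp, Kzero_eq_diffOp, Kzero_eq_diffOp, Kzero_eq_diffOp,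
    opComm_diffOp hw (hasFDerivAt_const _ _) (hasFDerivAt_const _ _) hX hY hf]
  have hV : (2 : ℂ) • (Y' (symProd (mat w j) (δ i)) - X' (symProd (mat w a) (δ b))) =
      δ a i • symProd (mat w j) (δ b) - δ b j • symProd (mat w a) (δ i) := by
    refine coord_ext fun p q => ?_
    simp only [hX', hY', mat_sub, mat_smul, Matrix.sub_apply,
      Matrix.smul_apply, smul_eq_mul, mat_symProd]
    rw [δ_comm i a, mat_symm w j a]
    ring
  have hV' := congrArg (fderiv ℂ f w) hV
  simp only [map_sub, map_smul, smul_eq_mul] at hV'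
  simp only [diffOp, _root_.zero_apply, sub_self, zero_mul, zero_add, map_sub, hV']
  rw [δ_comm j b]
  ring

lemma Kminus_swap {n : ℕ} (a b : Fin n) : (Kminus b a : Op n) = Kminus a b := by
  funext f w
  simp only [Kminus, nabla, pderiv, δ_comm b a, Sym2.eq_swap (a := b)]

/-! ### The derivative of the determinant of `1 - W W̄` -/

/-- The determinant as a continuous multilinear function of the rows. -/
noncomputable def detCMM (n : ℕ) :
    ContinuousMultilinearMap ℂ (fun _ : Fin n => Fin n → ℂ) ℂ where
  toMultilinearMap := (detRowAlternating : (Fin n → ℂ) [⋀^Fin n]→ₗ[ℂ] ℂ).toMultilinearMap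
  cont := by
    change Continuous fun M : Matrix (Fin n) (Fin n) ℂ => M.det
    exact continuous_id.matrix_det

/-- Jacobi's formula. -/
lemma detCMM_linearDeriv {n : ℕ} (A B : Matrix (Fin n) (Fin n) ℂ) :
    (detCMM n).linearDeriv A B = (A.adjugate * B).trace := by
  refine (ContinuousMultilinearMap.linearDeriv_apply (detCMM n) A B).trans ?_
  have h : ∀ i, detCMM n (Function.update A i (B i)) = (B * A.adjugate) i i := by
    intro i
    change (A.updateRow i (B i)).det = _
    rw [← cramer_transpose_apply, cramer_eq_adjugate_mulVec, ← adjugate_transpose]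
    simp [mulVec, dotProduct, Matrix.mul_apply, mul_comm]
  rw [Finset.sum_congr rfl fun i _ => h i, trace_mul_comm]
  rfl

/-- The conjugation of a coordinate, as a real linear map. -/
noncomputable def conjCoord {n : ℕ} (p : Sym2 (Fin n)) : Coord n →L[ℝ] ℂ :=
  Complex.conjCLE.toContinuousLinearMap.comp
    ((ContinuousLinearMap.proj p : Coord n →L[ℂ] ℂ).restrictScalars ℝ)

lemma conjCoord_apply {n : ℕ} (p : Sym2 (Fin n)) (w : Coord n) :
    conjCoord p w = starRingEnd ℂ (w p) := rfl

lemma hasFDerivAt_gap {n : ℕ} (w : Coord n) :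
    ∃ L : Coord n →L[ℝ] (Fin n → Fin n → ℂ),
      HasFDerivAt (fun w : Coord n => (gap w : Fin n → Fin n → ℂ)) L w ∧
        ∀ V,
          L V = -(mat V * (mat w).map (starRingEnd ℂ) + mat w * (mat V).map (starRingEnd ℂ)) := by
  have key : ∀ i j : Fin n, HasFDerivAt (fun w : Coord n => gap w i j)
      (-∑ l, ((mat w i l) • conjCoord s(l, j) + (starRingEnd ℂ (mat w l j)) •
        ((entryCLM i l).restrictScalars ℝ : Coord n →L[ℝ] ℂ))) w := by
    intro i j
    have h : (fun w : Coord n => gap w i j) = fun w =>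
        (1 : Matrix (Fin n) (Fin n) ℂ) i j - ∑ l, mat w i l * starRingEnd ℂ (mat w l j) := by
      funext w
      simp [gap, Matrix.mul_apply]
    rw [h]
    refine HasFDerivAt.const_sub (HasFDerivAt.fun_sum fun l _ => ?_) _
    exact ((entryCLM i l).hasFDerivAt.restrictScalars ℝ).mul (conjCoord s(l, j)).hasFDerivAt
  refine ⟨_, hasFDerivAt_pi.2 fun i => hasFDerivAt_pi.2 fun j => key i j, fun V => ?_⟩
  ext i j
  simp only [ContinuousLinearMap.coe_pi', _root_.neg_apply, Matrix.neg_apply, Matrix.add_apply,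
    Matrix.mul_apply, Matrix.map_apply, _root_.sum_apply, _root_.add_apply, _root_.smul_apply,
    smul_eq_mul, Finset.sum_add_distrib, conjCoord_apply]
  rw [add_comm]
  congr 2
  exact Finset.sum_congr rfl fun l _ => mul_comm _ _

lemma hasFDerivAt_det_gap {n : ℕ} (w : Coord n) :
    ∃ L : Coord n →L[ℝ] ℝ, HasFDerivAt (fun w : Coord n => (gap w).det.re) L w ∧
      ∀ V, ((L V : ℝ) : ℂ) = -((gap w).adjugate * (mat V * (mat w).map (starRingEnd ℂ) +
        mat w * (mat V).map (starRingEnd ℂ))).trace := by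
  obtain ⟨L, hL, hL'⟩ := hasFDerivAt_gap w
  have h1 : HasFDerivAt (fun w : Coord n => (gap w).det)
      (((detCMM n).linearDeriv (gap w)).restrictScalars ℝ ∘SL L) w :=
    (((detCMM n).hasFDerivAt (gap w)).restrictScalars ℝ).comp w hL
  have h2 : HasFDerivAt (fun w : Coord n => (gap w).det.re)
      (Complex.reCLM ∘SL (((detCMM n).linearDeriv (gap w)).restrictScalars ℝ ∘SL L)) w :=
    Complex.reCLM.hasFDerivAt.comp w h1
  refine ⟨_, h2, fun V => ?_⟩
  have h3 : HasFDerivAt (fun w : Coord n => (gap w).det)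
      (Complex.ofRealCLM ∘SL
        (Complex.reCLM ∘SL (((detCMM n).linearDeriv (gap w)).restrictScalars ℝ ∘SL L))) w := by
    have : (fun w : Coord n => (gap w).det) = fun w => (((gap w).det.re : ℝ) : ℂ) :=
      funext det_gap_eq_re
    rw [this]
    exact Complex.ofRealCLM.hasFDerivAt.comp w h2
  have h4 := congrArg (fun M : Coord n →L[ℝ] ℂ => M V) (h3.unique h1)
  refine h4.trans ?_
  change (detCMM n).linearDeriv (gap w) (L V) = _
  rw [hL', detCMM_linearDeriv, mul_neg, trace_neg]

lemma contDiff_det_gap {n : ℕ} : ContDiff ℝ 1 fun w : Coord n => (gap w).det.re := by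
  have hentry : ∀ p : Sym2 (Fin n), ContDiff ℝ 1 fun w : Coord n => w p := fun p =>
    ((ContinuousLinearMap.proj p : Coord n →L[ℂ] ℂ).restrictScalars ℝ).contDiff
  have hgap : ∀ i j, ContDiff ℝ 1 fun w : Coord n => gap w i j := by
    intro i j
    have h : (fun w : Coord n => gap w i j) = fun w =>
        (1 : Matrix (Fin n) (Fin n) ℂ) i j - ∑ l, mat w i l * starRingEnd ℂ (mat w l j) := by
      funext w
      simp [gap, Matrix.mul_apply]
    rw [h]
    exact contDiff_const.sub (ContDiff.sum fun l _ =>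
      (hentry s(i, l)).mul (conjCoord s(l, j)).contDiff)
  refine Complex.reCLM.contDiff.comp ?_
  simp only [det_apply]
  exact ContDiff.sum fun σ _ => ContDiff.const_smul _ (contDiff_prod fun i _ => hgap _ _)

/-! ### Wirtinger derivatives -/

/-- The complex linear part of a real linear functional: for `L = dψ` this is the Wirtinger
derivative `∂ψ` in the direction `E`. -/
noncomputable def wirt {n : ℕ} (L : Coord n →L[ℝ] ℂ) (E : Coord n) : ℂ :=
  (L E - Complex.I * L (Complex.I • E)) / 2

lemma wirt_smul {n : ℕ} (L : Coord n →L[ℝ] ℂ) (c : ℂ) (E : Coord n) :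
    wirt L (c • E) = c * wirt L E := by
  have h : ∀ V, L (c • V) = c.re * L V + c.im * L (Complex.I • V) := by
    intro V
    have : c • V = c.re • V + c.im • (Complex.I • V) := by
      conv_lhs => rw [← Complex.re_add_im c]
      rw [add_smul, mul_smul]; rfl
    rw [this, map_add, map_smul, map_smul]
    simp
  have h2 : L (Complex.I • Complex.I • E) = -L E := by
    rw [smul_smul, Complex.I_mul_I, neg_one_smul, map_neg]
  simp only [wirt]
  rw [smul_comm, h, h, h2]
  conv_rhs => rw [← Complex.re_add_im c]
  linear_combination ((c.im : ℂ) * L (Complex.I • E) / 2) * Complex.I_sq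

lemma wirt_sum {n : ℕ} {ι : Type*} (L : Coord n →L[ℝ] ℂ) (s : Finset ι) (E : ι → Coord n) :
    wirt L (∑ i ∈ s, E i) = ∑ i ∈ s, wirt L (E i) := by
  simp only [wirt, Finset.smul_sum, map_sum, Finset.mul_sum, ← Finset.sum_sub_distrib,
    Finset.sum_div]

lemma wirt_det_gap {n : ℕ} {w : Coord n} {L : Coord n →L[ℝ] ℝ}
    (hL : ∀ V, ((L V : ℝ) : ℂ) = -((gap w).adjugate * (mat V * (mat w).map (starRingEnd ℂ) +
        mat w * (mat V).map (starRingEnd ℂ))).trace) (E : Coord n) :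
    wirt (Complex.ofRealCLM ∘SL L) E =
      -((gap w).adjugate * (mat E * (mat w).map (starRingEnd ℂ))).trace := by
  simp only [wirt, ContinuousLinearMap.comp_apply, Complex.ofRealCLM_apply, hL]
  have h : (mat (Complex.I • E)).map (starRingEnd ℂ) =
      -(Complex.I • (mat E).map (starRingEnd ℂ)) := by
    ext i j; simp [mat_smul]
  rw [h, mat_smul]
  simp only [mul_add, trace_add, Matrix.smul_mul, Matrix.mul_smul, trace_smul, Matrix.mul_neg,
    trace_neg, smul_eq_mul]
  linear_combination ((gap w).adjugate * (mat E * (mat w).map (starRingEnd ℂ))).trace / 2 *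
      Complex.I_sq - ((gap w).adjugate * (mat w * (mat E).map (starRingEnd ℂ))).trace / 2 *
      Complex.I_sq

/-! ### Integration by parts with compactly supported test functions -/

lemma integral_fderiv_eq_zero {n : ℕ} {Φ : Coord n → ℂ} (hΦ : ContDiff ℝ 1 Φ)
    (hc : HasCompactSupport Φ) (v : Coord n) : ∫ w, fderiv ℝ Φ w v = 0 := by
  have hd : Continuous fun w => fderiv ℝ Φ w v :=
    (hΦ.continuous_fderiv one_ne_zero).clm_apply continuous_const
  have hdc : HasCompactSupport fun w => fderiv ℝ Φ w v :=
    (hc.fderiv (𝕜 := ℝ)).comp_left (g := fun L : Coord n →L[ℝ] ℂ => L v) rfl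
  have h := integral_mul_fderiv_eq_neg_fderiv_mul_of_integrable (μ := (volume : Measure (Coord n)))
    (f := fun _ : Coord n => (1 : ℂ)) (g := Φ) (v := v)
    (by simp) (by simpa using hd.integrable_of_hasCompactSupport hdc)
    (by simpa using hΦ.continuous.integrable_of_hasCompactSupport hc)
    (fun _ _ => differentiableAt_const _)
    (fun _ _ => hΦ.differentiable one_ne_zero _)
  simpa using h

lemma integral_wirt_eq_zero {n : ℕ} {Φ : Coord n → ℂ} (hΦ : ContDiff ℝ 1 Φ)
    (hc : HasCompactSupport Φ) (E : Coord n) : ∫ w, wirt (fderiv ℝ Φ w) E = 0 := by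
  have hi : ∀ v, Integrable fun w => fderiv ℝ Φ w v := fun v =>
    ((hΦ.continuous_fderiv one_ne_zero).clm_apply continuous_const).integrable_of_hasCompactSupport
      ((hc.fderiv (𝕜 := ℝ)).comp_left (g := fun L : Coord n →L[ℝ] ℂ => L v) rfl)
  simp only [wirt]
  rw [integral_div, integral_sub (hi _) ((hi _).const_mul _), integral_const_mul,
    integral_fderiv_eq_zero hΦ hc, integral_fderiv_eq_zero hΦ hc]
  simp

/-- `ψ` vanishes on the ball outside a compact subset of the ball. -/
def VanishesNearBoundary {n : ℕ} (ψ : Coord n → ℂ) : Prop :=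
  ∃ K, IsCompact K ∧ K ⊆ ball n ∧ ∀ w ∈ ball n, w ∉ K → ψ w = 0

lemma VanishesNearBoundary.mul_left {n : ℕ} {ψ : Coord n → ℂ} (h : VanishesNearBoundary ψ)
    (φ : Coord n → ℂ) : VanishesNearBoundary fun w => φ w * ψ w := by
  obtain ⟨K, hK, hKb, h0⟩ := h
  exact ⟨K, hK, hKb, fun w hw hwK => mul_eq_zero_of_right _ (h0 w hw hwK)⟩

lemma VanishesNearBoundary.wirt_fderiv {n : ℕ} {ψ : Coord n → ℂ} (h : VanishesNearBoundary ψ)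
    (E : Coord n → Coord n) : VanishesNearBoundary fun w => wirt (fderiv ℝ ψ w) (E w) := by
  obtain ⟨K, hK, hKb, h0⟩ := h
  refine ⟨K, hK, hKb, fun w hw hwK => ?_⟩
  have : ψ =ᶠ[𝓝 w] fun _ => 0 := by
    filter_upwards [isOpen_ball.mem_nhds hw, hK.isClosed.isOpen_compl.mem_nhds hwK] with v hv hvK
    exact h0 v hv hvK
  simp only [this.fderiv_eq, wirt]
  simp

lemma VanishesNearBoundary.integrableOn {n : ℕ} {ψ : Coord n → ℂ} (h : VanishesNearBoundary ψ)
    (hc : ContinuousOn ψ (ball n)) : IntegrableOn ψ (ball n) := by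
  obtain ⟨K, hK, hKb, h0⟩ := h
  have h1 : IntegrableOn ψ K := (hc.mono hKb).integrableOn_compact hK
  exact h1.of_forall_sdiff_eq_zero isOpen_ball.measurableSet fun w hw => h0 w hw.1 hw.2

lemma IsHol.continuousOn {n : ℕ} {f : Coord n → ℂ} (hf : IsHol f) : ContinuousOn f (ball n) :=
  AnalyticOnNhd.continuousOn hf

lemma IsHol.contDiffAt_real {n : ℕ} {f : Coord n → ℂ} (hf : IsHol f) {w : Coord n}
    (hw : w ∈ ball n) : ContDiffAt ℝ 1 f w :=
  (hf w hw).contDiffAt.restrict_scalars ℝ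

lemma continuousOn_conj {n : ℕ} {f : Coord n → ℂ} (hf : ContinuousOn f (ball n)) :
    ContinuousOn (fun w => starRingEnd ℂ (f w)) (ball n) :=
  Complex.continuous_conj.comp_continuousOn hf

lemma IsHol.continuousOn_fderiv_apply {n : ℕ} {f : Coord n → ℂ} (hf : IsHol f)
    {Y : Coord n → Coord n} (hY : ContinuousOn Y (ball n)) :
    ContinuousOn (fun w => fderiv ℂ f w (Y w)) (ball n) :=
  (AnalyticOnNhd.continuousOn hf.fderiv).clm_apply hY

lemma continuousOn_wirt {n : ℕ} {ψ : Coord n → ℂ} (hψ : ContDiffOn ℝ 1 ψ (ball n))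
    {E : Coord n → Coord n} (hE : ContinuousOn E (ball n)) :
    ContinuousOn (fun w => wirt (fderiv ℝ ψ w) (E w)) (ball n) := by
  have h := hψ.continuousOn_fderiv_of_isOpen isOpen_ball le_rfl
  have h1 : ContinuousOn (fun w => fderiv ℝ ψ w (E w)) (ball n) := h.clm_apply hE
  have hI : ContinuousOn (fun w => Complex.I • E w) (ball n) := hE.const_smul Complex.I
  have h2 : ContinuousOn (fun w => fderiv ℝ ψ w (Complex.I • E w)) (ball n) := h.clm_apply hI
  have h3 : ContinuousOn (fun w => Complex.I * fderiv ℝ ψ w (Complex.I • E w)) (ball n) :=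
    continuousOn_const.mul h2
  exact (h1.sub h3).div_const 2

lemma integral_conj_mul_fderiv {n : ℕ} {f g ψ : Coord n → ℂ} (hf : IsHol f) (hg : IsHol g)
    (hψ : ContDiffOn ℝ 1 ψ (ball n)) (h0 : VanishesNearBoundary ψ) (E : Coord n) :
    ∫ w in ball n, starRingEnd ℂ (f w) * fderiv ℂ g w E * ψ w =
      -∫ w in ball n, starRingEnd ℂ (f w) * g w * wirt (fderiv ℝ ψ w) E := by
  set Φ : Coord n → ℂ := (ball n).indicator fun w => starRingEnd ℂ (f w) * g w * ψ w with hΦ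
  have hΦ0 : ∃ K, IsCompact K ∧ K ⊆ ball n ∧ ∀ w, w ∉ K → Φ w = 0 := by
    obtain ⟨K, hK, hKb, h0⟩ := h0
    refine ⟨K, hK, hKb, fun w hwK => ?_⟩
    by_cases hw : w ∈ ball n
    · rw [hΦ, Set.indicator_of_mem hw, h0 w hw hwK, mul_zero]
    · rw [hΦ, Set.indicator_of_notMem hw]
  obtain ⟨K, hK, hKb, hK0⟩ := hΦ0
  have hzero : ∀ w, w ∉ ball n → Φ =ᶠ[𝓝 w] fun _ => 0 := by
    intro w hw
    filter_upwards [hK.isClosed.isOpen_compl.mem_nhds fun h => hw (hKb h)] with v hv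
    exact hK0 v hv
  have hin : ∀ w ∈ ball n, Φ =ᶠ[𝓝 w] fun w => starRingEnd ℂ (f w) * g w * ψ w := by
    intro w hw
    filter_upwards [isOpen_ball.mem_nhds hw] with v hv
    rw [hΦ, Set.indicator_of_mem hv]
  have hsmooth : ContDiff ℝ 1 Φ := by
    refine contDiff_iff_contDiffAt.2 fun w => ?_
    by_cases hw : w ∈ ball n
    · refine ContDiffAt.congr_of_eventuallyEq ?_ (hin w hw)
      exact ((Complex.conjCLE.contDiff.contDiffAt.comp w (hf.contDiffAt_real hw)).mul
        (hg.contDiffAt_real hw)).mul (hψ.contDiffAt (isOpen_ball.mem_nhds hw))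
    · exact contDiffAt_const.congr_of_eventuallyEq (hzero w hw)
  have h1 := integral_wirt_eq_zero hsmooth (HasCompactSupport.intro hK hK0) E
  rw [← setIntegral_eq_integral_of_forall_compl_eq_zero (s := ball n)] at h1
  swap
  · intro w hw
    simp only [(hzero w hw).fderiv_eq, wirt]
    simp
  have h2 : ∀ w ∈ ball n, wirt (fderiv ℝ Φ w) E = starRingEnd ℂ (f w) * fderiv ℂ g w E * ψ w +
      starRingEnd ℂ (f w) * g w * wirt (fderiv ℝ ψ w) E := by
    intro w hw
    have hf' := Complex.conjCLE.toContinuousLinearMap.hasFDerivAt.comp w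
      ((differentiableAt_of_isHol hf hw).hasFDerivAt.restrictScalars ℝ)
    have hg' := (differentiableAt_of_isHol hg hw).hasFDerivAt.restrictScalars ℝ
    have hψ' := ((hψ.contDiffAt (isOpen_ball.mem_nhds hw)).differentiableAt
      one_ne_zero).hasFDerivAt
    have h3 := (hf'.mul hg').mul hψ'
    have h4 : fderiv ℝ Φ w = _ := (hin w hw).fderiv_eq.trans h3.fderiv
    rw [h4]
    simp only [wirt, _root_.add_apply, _root_.smul_apply, ContinuousLinearMap.comp_apply,
      ContinuousLinearMap.coe_restrictScalars', smul_eq_mul, map_smul, Function.comp_apply,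
      Pi.mul_apply,
      ContinuousLinearEquiv.coe_coe, Complex.conjCLE_apply, map_mul, Complex.conj_I]
    linear_combination (-(starRingEnd ℂ (f w) * fderiv ℂ g w E * ψ w / 2) +
      (starRingEnd ℂ) ((fderiv ℂ f w) E) * g w * ψ w / 2) * Complex.I_sq
  rw [setIntegral_congr_fun isOpen_ball.measurableSet h2, integral_add] at h1
  · exact eq_neg_of_add_eq_zero_left h1
  · exact (h0.mul_left _).integrableOn (((continuousOn_conj hf.continuousOn).mul
      (hg.continuousOn_fderiv_apply continuousOn_const)).mul hψ.continuousOn)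
  · exact ((h0.wirt_fderiv fun _ => E).mul_left _).integrableOn
      (((continuousOn_conj hf.continuousOn).mul hg.continuousOn).mul
        (continuousOn_wirt hψ continuousOn_const))

/-- The divergence of a vector field on symmetric matrices whose derivative at a point is `L`. -/
noncomputable def divg {n : ℕ} (L : Coord n →L[ℂ] Coord n) : ℂ :=
  ∑ i, ∑ j, mat (L (symProd (δ i) (δ j))) i j

lemma eq_sum_symProd {n : ℕ} (V : Coord n) :
    V = ∑ i, ∑ j, mat V i j • symProd (δ i) (δ j) := by
  refine coord_ext fun p q => ?_
  have h : mat (∑ i, ∑ j, mat V i j • symProd (δ i) (δ j)) p q =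
      ∑ i, ∑ j, mat V i j * ((δ i p * δ j q + δ i q * δ j p) / 2) := by
    simp [mat, Finset.sum_apply, symProd]
  rw [h]
  simp only [δ, mul_div_assoc', mul_add, ← Finset.sum_div, Finset.sum_add_distrib]
  simp [mat_symm V q p]

/-- Integration by parts against a holomorphic vector field. -/
lemma integral_conj_mul_field {n : ℕ} {f g ψ : Coord n → ℂ} (hf : IsHol f) (hg : IsHol g)
    (hψ : ContDiffOn ℝ 1 ψ (ball n)) (h0 : VanishesNearBoundary ψ) {Y : Coord n → Coord n}
    (hY : ContDiff ℂ 1 Y) :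
    ∫ w in ball n, starRingEnd ℂ (f w) * fderiv ℂ g w (Y w) * ψ w =
      -∫ w in ball n, starRingEnd ℂ (f w) * g w *
        (divg (fderiv ℂ Y w) * ψ w + wirt (fderiv ℝ ψ w) (Y w)) := by
  have hYc : ∀ i j, ContDiff ℝ 1 fun w => mat (Y w) i j := fun i j =>
    ((entryCLM i j).contDiff.comp hY).restrict_scalars ℝ
  have hψY : ∀ i j, ContDiffOn ℝ 1 (fun w => mat (Y w) i j * ψ w) (ball n) := fun i j =>
    (hYc i j).contDiffOn.mul hψ
  have h0Y : ∀ i j, VanishesNearBoundary fun w => mat (Y w) i j * ψ w := fun i j => h0.mul_left _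
  have hL : ∀ w ∈ ball n, starRingEnd ℂ (f w) * fderiv ℂ g w (Y w) * ψ w =
      ∑ i, ∑ j, starRingEnd ℂ (f w) * fderiv ℂ g w (symProd (δ i) (δ j)) *
        (mat (Y w) i j * ψ w) := by
    intro w _
    conv_lhs => rw [eq_sum_symProd (Y w)]
    simp only [map_sum, map_smul, smul_eq_mul, Finset.mul_sum, Finset.sum_mul]
    exact Finset.sum_congr rfl fun i _ => Finset.sum_congr rfl fun j _ => by ring
  have hR : ∀ w ∈ ball n, starRingEnd ℂ (f w) * g w *
        (divg (fderiv ℂ Y w) * ψ w + wirt (fderiv ℝ ψ w) (Y w)) =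
      ∑ i, ∑ j, starRingEnd ℂ (f w) * g w *
        wirt (fderiv ℝ (fun w => mat (Y w) i j * ψ w) w) (symProd (δ i) (δ j)) := by
    intro w hw
    have hd : ∀ i j, wirt (fderiv ℝ (fun w => mat (Y w) i j * ψ w) w) (symProd (δ i) (δ j)) =
        mat (fderiv ℂ Y w (symProd (δ i) (δ j))) i j * ψ w +
          mat (Y w) i j * wirt (fderiv ℝ ψ w) (symProd (δ i) (δ j)) := by
      intro i j
      have h1 : HasFDerivAt (fun w => mat (Y w) i j)
          (((entryCLM i j).comp (fderiv ℂ Y w)).restrictScalars ℝ) w :=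
        ((entryCLM i j).hasFDerivAt.comp w
          ((hY.differentiable one_ne_zero) w).hasFDerivAt).restrictScalars ℝ
      have h2 := ((hψ.contDiffAt (isOpen_ball.mem_nhds hw)).differentiableAt
        one_ne_zero).hasFDerivAt
      rw [(h1.fun_mul h2).fderiv]
      simp only [wirt, _root_.add_apply, _root_.smul_apply, ContinuousLinearMap.comp_apply,
        ContinuousLinearMap.coe_restrictScalars', smul_eq_mul, map_smul, entryCLM_apply]
      linear_combination (-(ψ w * mat (fderiv ℂ Y w (symProd (δ i) (δ j))) i j / 2)) * Complex.I_sq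
    simp only [hd]
    conv_lhs => enter [2, 2]; rw [eq_sum_symProd (Y w)]
    simp only [wirt_sum, wirt_smul, divg, Finset.sum_mul, ← Finset.sum_add_distrib, Finset.mul_sum]
  rw [setIntegral_congr_fun isOpen_ball.measurableSet hL,
    setIntegral_congr_fun isOpen_ball.measurableSet hR, integral_finsetSum, integral_finsetSum,
    ← Finset.sum_neg_distrib]
  · refine Finset.sum_congr rfl fun i _ => ?_
    rw [integral_finsetSum, integral_finsetSum, ← Finset.sum_neg_distrib]
    · exact Finset.sum_congr rfl fun j _ => integral_conj_mul_fderiv hf hg (hψY i j) (h0Y i j) _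
    · intro j _
      exact (((h0Y i j).wirt_fderiv fun _ => _).mul_left _).integrableOn
        (((continuousOn_conj hf.continuousOn).mul hg.continuousOn).mul
          (continuousOn_wirt (hψY i j) continuousOn_const))
    · intro j _
      exact ((h0Y i j).mul_left _).integrableOn (((continuousOn_conj hf.continuousOn).mul
        (hg.continuousOn_fderiv_apply continuousOn_const)).mul (hψY i j).continuousOn)
  · intro i _
    refine integrable_finsetSum _ fun j _ => ?_
    exact (((h0Y i j).wirt_fderiv fun _ => _).mul_left _).integrableOn
        (((continuousOn_conj hf.continuousOn).mul hg.continuousOn).mul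
          (continuousOn_wirt (hψY i j) continuousOn_const))
  · intro i _
    refine integrable_finsetSum _ fun j _ => ?_
    exact ((h0Y i j).mul_left _).integrableOn (((continuousOn_conj hf.continuousOn).mul
        (hg.continuousOn_fderiv_apply continuousOn_const)).mul (hψY i j).continuousOn)

/-! ### Cutoffs of the weight -/

lemma hasDerivAt_posPart_sq (x : ℝ) : HasDerivAt (fun x : ℝ => max x 0 ^ 2) (2 * max x 0) x := by
  rcases lt_trichotomy x 0 with hx | rfl | hx
  · rw [max_eq_right hx.le, mul_zero]
    refine (hasDerivAt_const x (0 : ℝ)).congr_of_eventuallyEq ?_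
    filter_upwards [gt_mem_nhds hx] with y hy
    simp [max_eq_right hy.le]
  · rw [max_self, mul_zero]
    have h : HasDerivAt (fun x : ℝ => x ^ 2) 0 0 := by simpa using hasDerivAt_pow 2 (0 : ℝ)
    rw [hasDerivAt_iff_isLittleO_nhds_zero] at h ⊢
    refine Asymptotics.IsBigO.trans_isLittleO (Asymptotics.IsBigO.of_norm_le fun y => ?_) h
    simp only [zero_add, max_self, ne_eq, OfNat.ofNat_ne_zero, not_false_eq_true, zero_pow,
      smul_eq_mul, mul_zero, sub_zero, norm_pow, Real.norm_eq_abs, sq_abs]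
    rcases le_total y 0 with hy | hy
    · rw [max_eq_right hy]; nlinarith [sq_nonneg y]
    · rw [max_eq_left hy]
  · rw [max_eq_left hx.le]
    have h : HasDerivAt (fun x : ℝ => x ^ 2) (2 * x) x := by simpa using hasDerivAt_pow 2 x
    refine h.congr_of_eventuallyEq ?_
    filter_upwards [lt_mem_nhds hx] with y hy
    rw [max_eq_left hy.le]

lemma contDiff_posPart_sq : ContDiff ℝ 1 fun x : ℝ => max x 0 ^ 2 := by
  rw [contDiff_one_iff_deriv]
  refine ⟨fun x => (hasDerivAt_posPart_sq x).differentiableAt, ?_⟩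
  rw [funext fun x => (hasDerivAt_posPart_sq x).deriv]
  fun_prop

/-- The truncation `t ^ (q - 2) * (t - ε)₊ ^ 2` of the power `t ^ q`: it is continuously
differentiable for `t > 0`, vanishes for `t ≤ ε`, and tends to `t ^ q` as `ε → 0`. -/
noncomputable def cutoff (q ε t : ℝ) : ℝ := t ^ (q - 2) * max (t - ε) 0 ^ 2

/-- The deviation of `cutoff q ε` from being homogeneous of degree `q`. -/
noncomputable def cutoffDefect (q ε t : ℝ) : ℝ :=
  2 * t ^ (q - 2) * max (t - ε) 0 * (max (t - ε) 0 - t)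

lemma hasDerivAt_cutoff (q ε : ℝ) {t : ℝ} (ht : 0 < t) :
    ∃ d, HasDerivAt (cutoff q ε) d t ∧ q * cutoff q ε t - t * d = cutoffDefect q ε t := by
  have h1 : HasDerivAt (fun t : ℝ => t ^ (q - 2)) ((q - 2) * t ^ (q - 2 - 1)) t :=
    Real.hasDerivAt_rpow_const (Or.inl ht.ne')
  have h2 : HasDerivAt (fun t : ℝ => max (t - ε) 0 ^ 2) (2 * max (t - ε) 0) t :=
    (hasDerivAt_posPart_sq (t - ε)).comp_sub_const t ε
  refine ⟨_, h1.mul h2, ?_⟩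
  have h3 : t ^ (q - 2) = t ^ (q - 2 - 1) * t := by
    rw [← Real.rpow_add_one ht.ne']; ring_nf
  simp only [cutoff, cutoffDefect]
  rw [h3]
  ring

lemma contDiffOn_cutoff (q ε : ℝ) : ContDiffOn ℝ 1 (cutoff q ε) (Set.Ioi 0) := by
  refine ContDiffOn.mul (fun t ht => ?_) ?_
  · exact (Real.contDiffAt_rpow_const_of_ne (ne_of_gt ht)).contDiffWithinAt
  · exact (contDiff_posPart_sq.comp (contDiff_id.sub contDiff_const)).contDiffOn

lemma cutoff_eq_zero (q : ℝ) {ε t : ℝ} (h : t ≤ ε) : cutoff q ε t = 0 := by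
  simp [cutoff, max_eq_right (sub_nonpos.2 h)]

lemma posPart_le {ε t : ℝ} (hε : 0 ≤ ε) (ht : 0 < t) : max (t - ε) 0 ≤ t :=
  max_le (by linarith) ht.le

lemma abs_cutoff_le (q : ℝ) {ε t : ℝ} (hε : 0 ≤ ε) (ht : 0 < t) : |cutoff q ε t| ≤ t ^ q := by
  have h1 := posPart_le hε ht
  have h2 : (0 : ℝ) ≤ max (t - ε) 0 := le_max_right _ _
  have h3 : t ^ q = t ^ (q - 2) * t ^ 2 := by
    rw [← Real.rpow_natCast t 2, ← Real.rpow_add ht]; norm_num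
  rw [cutoff, abs_of_nonneg (by positivity), h3]
  gcongr

lemma abs_cutoffDefect_le (q : ℝ) {ε t : ℝ} (hε : 0 ≤ ε) (ht : 0 < t) :
    |cutoffDefect q ε t| ≤ 2 * t ^ q := by
  have h1 := posPart_le hε ht
  have h2 : (0 : ℝ) ≤ max (t - ε) 0 := le_max_right _ _
  have h3 : t ^ q = t ^ (q - 2) * t ^ 2 := by
    rw [← Real.rpow_natCast t 2, ← Real.rpow_add ht]; norm_num
  have h4 : 0 < t ^ (q - 2) := Real.rpow_pos_of_pos ht _
  rw [cutoffDefect, h3, abs_mul, abs_of_nonneg (by positivity), abs_of_nonpos (by linarith)]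
  calc 2 * t ^ (q - 2) * max (t - ε) 0 * -(max (t - ε) 0 - t)
      ≤ 2 * t ^ (q - 2) * t * t := by gcongr <;> linarith
    _ = _ := by ring

lemma tendsto_cutoff (q : ℝ) {t : ℝ} (ht : 0 < t) :
    Tendsto (fun ε => cutoff q ε t) (𝓝[>] 0) (𝓝 (t ^ q)) := by
  have h : Continuous fun ε => cutoff q ε t := by unfold cutoff; fun_prop
  have h0 : cutoff q 0 t = t ^ q := by
    rw [cutoff, sub_zero, max_eq_left ht.le, ← Real.rpow_natCast t 2, ← Real.rpow_add ht]
    norm_num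
  have h1 := (h.tendsto 0).mono_left (nhdsWithin_le_nhds (s := Set.Ioi 0))
  rwa [h0] at h1

lemma tendsto_cutoffDefect (q : ℝ) {t : ℝ} (ht : 0 < t) :
    Tendsto (fun ε => cutoffDefect q ε t) (𝓝[>] 0) (𝓝 0) := by
  have h : Continuous fun ε => cutoffDefect q ε t := by unfold cutoffDefect; fun_prop
  have h0 : cutoffDefect q 0 t = 0 := by
    rw [cutoffDefect, sub_zero, max_eq_left ht.le]; ring
  have h1 := (h.tendsto 0).mono_left (nhdsWithin_le_nhds (s := Set.Ioi 0))
  rwa [h0] at h1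

/-- The truncated weight as a complex valued test function on the ball. -/
noncomputable def testFn {n : ℕ} (q ε : ℝ) (w : Coord n) : ℂ := (cutoff q ε (gap w).det.re : ℝ)

lemma contDiffOn_testFn {n : ℕ} (q ε : ℝ) : ContDiffOn ℝ 1 (testFn (n := n) q ε) (ball n) :=
  Complex.ofRealCLM.contDiff.comp_contDiffOn
    ((contDiffOn_cutoff q ε).comp contDiff_det_gap.contDiffOn fun _ hw => det_gap_pos hw)

lemma vanishesNearBoundary_testFn {n : ℕ} (q : ℝ) {ε : ℝ} (hε : 0 < ε) :
    VanishesNearBoundary (testFn (n := n) q ε) := by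
  refine ⟨_, isCompact_superlevel, superlevel_subset_ball hε, fun w hw hwK => ?_⟩
  have : (gap w).det.re ≤ ε := by
    by_contra h
    exact hwK ⟨(mem_ball_iff.1 hw).le, (not_le.1 h).le⟩
  simp [testFn, cutoff_eq_zero q this]

lemma wirt_testFn {n : ℕ} (q ε : ℝ) {w : Coord n} (hw : w ∈ ball n) :
    ∃ d : ℝ, q * cutoff q ε (gap w).det.re - (gap w).det.re * d =
        cutoffDefect q ε (gap w).det.re ∧
      ∀ E, wirt (fderiv ℝ (testFn q ε) w) E =
        -(d * ((gap w).adjugate * (mat E * (mat w).map (starRingEnd ℂ))).trace) := by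
  obtain ⟨d, hd, hd'⟩ := hasDerivAt_cutoff q ε (det_gap_pos hw)
  obtain ⟨L, hL, hL'⟩ := hasFDerivAt_det_gap w
  refine ⟨d, hd', fun E => ?_⟩
  have h0 := hd.comp_hasFDerivAt w hL
  have h1 : HasFDerivAt (testFn q ε) (Complex.ofRealCLM ∘SL (d • L)) w :=
    Complex.ofRealCLM.hasFDerivAt.comp w h0
  have h2 : wirt (Complex.ofRealCLM ∘SL (d • L)) E = d * wirt (Complex.ofRealCLM ∘SL L) E := by
    simp only [wirt, ContinuousLinearMap.comp_apply, Complex.ofRealCLM_apply, _root_.smul_apply,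
      smul_eq_mul, Complex.ofReal_mul]
    ring
  rw [h1.fderiv, h2, wirt_det_gap hL']
  ring

/-! ### Formal adjoints -/

/-- The pointwise identities that make `β + Y` the formal adjoint of `α + X` for the weight
`det (1 - W W̄) ^ q`. The first compares the potentials with the divergences of the fields; the
second says that `Y - X̄` differentiates `det (1 - W W̄)` to a multiple of itself, so that it is
tangent to the boundary of the ball. -/
structure IsFormalAdjoint {n : ℕ} (q : ℝ) (α β : Coord n → ℂ) (X Y : Coord n → Coord n)
    (m : Coord n → ℂ) : Prop where
  potential : ∀ w ∈ ball n, starRingEnd ℂ (α w) - starRingEnd ℂ (divg (fderiv ℂ X w)) - β w +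
    divg (fderiv ℂ Y w) = q * m w
  tangent : ∀ w ∈ ball n,
    ((gap w).adjugate * (mat (Y w) * (mat w).map (starRingEnd ℂ))).trace -
      starRingEnd ℂ ((gap w).adjugate * (mat (X w) * (mat w).map (starRingEnd ℂ))).trace =
        (gap w).det * m w

/-- For the truncated weight there are no boundary terms, and the only obstruction to the adjoint
relation is the defect of the truncation. -/
lemma integral_truncated_adjoint {n : ℕ} {q ε : ℝ} (hε : 0 < ε) {α β m : Coord n → ℂ}
    {X Y : Coord n → Coord n} (hα : Continuous α) (hβ : Continuous β) (hX : ContDiff ℂ 1 X)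
    (hY : ContDiff ℂ 1 Y) (h : IsFormalAdjoint q α β X Y m) {f g : Coord n → ℂ}
    (hf : IsHol f) (hg : IsHol g) :
    ∫ w in ball n, (starRingEnd ℂ (diffOp α X f w) * g w - starRingEnd ℂ (f w) * diffOp β Y g w) *
        testFn q ε w =
      ∫ w in ball n, starRingEnd ℂ (f w) * g w * m w * (cutoffDefect q ε (gap w).det.re : ℝ) := by
  have hψ := contDiffOn_testFn (n := n) q ε
  have h0 := vanishesNearBoundary_testFn (n := n) q hε
  have hreal : ∀ w : Coord n, starRingEnd ℂ (testFn q ε w) = testFn q ε w := fun w =>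
    Complex.conj_ofReal _
  have hfc := hf.continuousOn
  have hgc := hg.continuousOn
  have hψc := hψ.continuousOn
  have hY1 := integral_conj_mul_field hf hg hψ h0 hY
  have hX1 := congrArg (starRingEnd ℂ) (integral_conj_mul_field hg hf hψ h0 hX)
  rw [map_neg, ← integral_conj, ← integral_conj] at hX1
  simp only [map_mul, map_add, Complex.conj_conj, hreal] at hX1
  have hYd : ContinuousOn (fun w => divg (fderiv ℂ Y w)) (ball n) := by
    unfold divg
    refine continuousOn_finsetSum _ fun i _ => continuousOn_finsetSum _ fun j _ => ?_
    exact ((entryCLM i j).continuous.comp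
      ((hY.continuous_fderiv one_ne_zero).clm_apply continuous_const)).continuousOn
  have hXd : ContinuousOn (fun w => divg (fderiv ℂ X w)) (ball n) := by
    unfold divg
    refine continuousOn_finsetSum _ fun i _ => continuousOn_finsetSum _ fun j _ => ?_
    exact ((entryCLM i j).continuous.comp
      ((hX.continuous_fderiv one_ne_zero).clm_apply continuous_const)).continuousOn
  have hwX := continuousOn_wirt hψ hX.continuous.continuousOn
  have hwY := continuousOn_wirt hψ hY.continuous.continuousOn
  have i1 : IntegrableOn (fun w => (starRingEnd ℂ (α w * f w) * g w -
      starRingEnd ℂ (f w) * (β w * g w)) * testFn q ε w) (ball n) :=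
    (h0.mul_left _).integrableOn ((((continuousOn_conj (hα.continuousOn.mul hfc)).mul hgc).sub
      ((continuousOn_conj hfc).mul (hβ.continuousOn.mul hgc))).mul hψc)
  have i2 : IntegrableOn (fun w => g w * starRingEnd ℂ (fderiv ℂ f w (X w)) * testFn q ε w)
      (ball n) :=
    (h0.mul_left _).integrableOn ((hgc.mul (continuousOn_conj
      (hf.continuousOn_fderiv_apply hX.continuous.continuousOn))).mul hψc)
  have i3 : IntegrableOn (fun w => starRingEnd ℂ (f w) * fderiv ℂ g w (Y w) * testFn q ε w)
      (ball n) :=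
    (h0.mul_left _).integrableOn (((continuousOn_conj hfc).mul
      (hg.continuousOn_fderiv_apply hY.continuous.continuousOn)).mul hψc)
  have i4 : IntegrableOn (fun w => g w * starRingEnd ℂ (f w) *
      (starRingEnd ℂ (divg (fderiv ℂ X w)) * testFn q ε w +
        starRingEnd ℂ (wirt (fderiv ℝ (testFn q ε) w) (X w)))) (ball n) := by
    have ha : IntegrableOn (fun w => g w * starRingEnd ℂ (f w) *
        starRingEnd ℂ (divg (fderiv ℂ X w)) * testFn q ε w) (ball n) :=
      (h0.mul_left _).integrableOn (((hgc.mul (continuousOn_conj hfc)).mul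
        (continuousOn_conj hXd)).mul hψc)
    have hb : IntegrableOn (fun w => g w * starRingEnd ℂ (f w) *
        starRingEnd ℂ (wirt (fderiv ℝ (testFn q ε) w) (X w))) (ball n) := by
      obtain ⟨K, hK, hKb, hK0⟩ := h0.wirt_fderiv X
      refine (VanishesNearBoundary.mul_left ⟨K, hK, hKb, fun w hw hwK => ?_⟩ _).integrableOn
        ((hgc.mul (continuousOn_conj hfc)).mul (continuousOn_conj hwX))
      rw [show wirt (fderiv ℝ (testFn q ε) w) (X w) = 0 from hK0 w hw hwK, map_zero]
    refine (ha.add hb).congr (ae_of_all _ fun w => ?_)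
    simp only [Pi.add_apply]; ring
  have i5 : IntegrableOn (fun w => starRingEnd ℂ (f w) * g w *
      (divg (fderiv ℂ Y w) * testFn q ε w + wirt (fderiv ℝ (testFn q ε) w) (Y w))) (ball n) := by
    have ha : IntegrableOn (fun w => starRingEnd ℂ (f w) * g w *
        divg (fderiv ℂ Y w) * testFn q ε w) (ball n) :=
      (h0.mul_left _).integrableOn ((((continuousOn_conj hfc).mul hgc).mul hYd).mul hψc)
    have hb : IntegrableOn (fun w => starRingEnd ℂ (f w) * g w *
        wirt (fderiv ℝ (testFn q ε) w) (Y w)) (ball n) :=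
      ((h0.wirt_fderiv Y).mul_left _).integrableOn (((continuousOn_conj hfc).mul hgc).mul hwY)
    refine (ha.add hb).congr (ae_of_all _ fun w => ?_)
    simp only [Pi.add_apply]; ring
  have hL : ∀ w ∈ ball n, (starRingEnd ℂ (diffOp α X f w) * g w -
      starRingEnd ℂ (f w) * diffOp β Y g w) * testFn q ε w =
      (starRingEnd ℂ (α w * f w) * g w - starRingEnd ℂ (f w) * (β w * g w)) * testFn q ε w +
        g w * starRingEnd ℂ (fderiv ℂ f w (X w)) * testFn q ε w -
        starRingEnd ℂ (f w) * fderiv ℂ g w (Y w) * testFn q ε w := by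
    intro w _
    simp only [diffOp, map_add, map_mul]
    ring
  have hsplit : ∀ {u v z : Coord n → ℂ}, IntegrableOn u (ball n) → IntegrableOn v (ball n) →
      IntegrableOn z (ball n) → ∫ w in ball n, (u w + v w - z w) =
        (∫ w in ball n, u w) + (∫ w in ball n, v w) - ∫ w in ball n, z w := by
    intro u v z hu hv hz
    have e1 := integral_sub (hu.add hv) hz
    have e2 := integral_add hu hv
    simp only [Pi.add_apply] at e1
    rw [e1, e2]
  have hsplit' : ∀ {u v z : Coord n → ℂ}, IntegrableOn u (ball n) → IntegrableOn v (ball n) →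
      IntegrableOn z (ball n) → ∫ w in ball n, (u w - v w + z w) =
        (∫ w in ball n, u w) - (∫ w in ball n, v w) + ∫ w in ball n, z w := by
    intro u v z hu hv hz
    have e1 := integral_add (hu.sub hv) hz
    have e2 := integral_sub hu hv
    simp only [Pi.sub_apply] at e1
    rw [e1, e2]
  rw [setIntegral_congr_fun isOpen_ball.measurableSet hL, hsplit i1 i2 i3, hX1, hY1,
    sub_neg_eq_add, ← sub_eq_add_neg, ← hsplit' i1 i4 i5]
  refine setIntegral_congr_fun isOpen_ball.measurableSet fun w hw => ?_
  obtain ⟨d, hd, hd'⟩ := wirt_testFn q ε hw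
  have e1 := h.potential w hw
  have e2 := h.tangent w hw
  rw [det_gap_eq_re] at e2
  have e3 : ((q : ℂ) * testFn q ε w - ((gap w).det.re : ℂ) * d) =
      (cutoffDefect q ε (gap w).det.re : ℝ) := by
    rw [← hd, testFn]; push_cast; rfl
  simp only [hd', map_mul, map_neg, Complex.conj_ofReal]
  rw [← e3]
  linear_combination (starRingEnd ℂ (f w) * g w * testFn q ε w) * e1 -
    (starRingEnd ℂ (f w) * g w * d) * e2

/-! ### The formal adjoints of the operators `K` -/

lemma mat_symProd_eq {n : ℕ} (u v : Fin n → ℂ) :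
    mat (symProd u v) = (1 / 2 : ℂ) • (vecMulVec u v + vecMulVec v u) := by
  ext p q
  simp [mat_symProd, vecMulVec_apply]
  ring

lemma trace_mul_symProd_mul {n : ℕ} (A B : Matrix (Fin n) (Fin n) ℂ) (hS : (B * A)ᵀ = B * A)
    (u v : Fin n → ℂ) : (A * (mat (symProd u v) * B)).trace = u ⬝ᵥ (B * A) *ᵥ v := by
  have key : ∀ x y : Fin n → ℂ, (A * (vecMulVec x y * B)).trace = y ⬝ᵥ (B * A) *ᵥ x := by
    intro x y
    rw [trace_mul_comm, Matrix.mul_assoc, vecMulVec_mul, trace_vecMulVec, dotProduct_comm,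
      ← dotProduct_mulVec]
  have hsymm : v ⬝ᵥ (B * A) *ᵥ u = u ⬝ᵥ (B * A) *ᵥ v := by
    rw [dotProduct_mulVec, ← mulVec_transpose, hS, dotProduct_comm]
  rw [mat_symProd_eq, Matrix.smul_mul, Matrix.mul_smul, trace_smul, Matrix.add_mul,
    Matrix.mul_add, trace_add, key, key, hsymm, smul_eq_mul]
  ring

lemma mat_transpose {n : ℕ} (w : Coord n) : (mat w)ᵀ = mat w := by
  ext i j; exact mat_symm w j i

lemma det_gap_ne_zero {n : ℕ} {w : Coord n} (hw : w ∈ ball n) : (gap w).det ≠ 0 := by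
  intro h
  have := det_gap_pos hw
  rw [h] at this
  simp at this

/-- `W̄ adj (1 - W W̄)` is symmetric. -/
lemma conj_mul_adjugate_gap_transpose {n : ℕ} {w : Coord n} (hw : w ∈ ball n) :
    ((mat w).map (starRingEnd ℂ) * (gap w).adjugate)ᵀ =
      (mat w).map (starRingEnd ℂ) * (gap w).adjugate := by
  set W := mat w
  set V := W.map (starRingEnd ℂ) with hV
  have hWt : Wᵀ = W := mat_transpose w
  have hVt : Vᵀ = V := by rw [hV, ← transpose_map, hWt]
  have hG : gap w = 1 - W * V := rfl
  have hGt : (gap w)ᵀ = 1 - V * W := by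
    rw [hG, transpose_sub, transpose_one, transpose_mul, hWt, hVt]
  have hint : V * gap w = (gap w)ᵀ * V := by
    rw [hG, ← hG, hGt, hG, Matrix.mul_sub, Matrix.sub_mul, Matrix.mul_one, Matrix.one_mul,
      Matrix.mul_assoc]
  have h1 : (gap w)ᵀ.adjugate * (V * gap w) * (gap w).adjugate =
      (gap w).det • ((gap w)ᵀ.adjugate * V) := by
    rw [Matrix.mul_assoc, Matrix.mul_assoc, mul_adjugate, Matrix.mul_smul, Matrix.mul_smul,
      Matrix.mul_one]
  have h2 : (gap w)ᵀ.adjugate * (V * gap w) * (gap w).adjugate =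
      (gap w).det • (V * (gap w).adjugate) := by
    rw [hint, ← Matrix.mul_assoc, adjugate_mul, det_transpose, Matrix.smul_mul, Matrix.smul_mul,
      Matrix.one_mul]
  rw [transpose_mul, adjugate_transpose, hVt]
  exact smul_right_injective _ (det_gap_ne_zero hw) (h1.symm.trans h2)

lemma mul_conj_mul_adjugate_gap {n : ℕ} (w : Coord n) :
    mat w * ((mat w).map (starRingEnd ℂ) * (gap w).adjugate) =
      (gap w).adjugate - (gap w).det • (1 : Matrix (Fin n) (Fin n) ℂ) := by
  have h : mat w * (mat w).map (starRingEnd ℂ) = 1 - gap w := by simp [gap]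
  rw [← Matrix.mul_assoc, h, Matrix.sub_mul, Matrix.one_mul, mul_adjugate]

lemma conj_adjugate_gap {n : ℕ} (w : Coord n) (i j : Fin n) :
    starRingEnd ℂ ((gap w).adjugate i j) = (gap w).adjugate j i := by
  have h : (gap w).adjugateᴴ = (gap w).adjugate := by
    rw [adjugate_conjTranspose, gap_isHermitian w]
  conv_rhs => rw [← h]
  rfl

lemma dotProduct_δ {n : ℕ} (u : Fin n → ℂ) (j : Fin n) : u ⬝ᵥ δ j = u j := by
  simp [dotProduct, δ]

lemma mulVec_δ {n : ℕ} (A : Matrix (Fin n) (Fin n) ℂ) (j : Fin n) : A *ᵥ δ j = fun i => A i j := by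
  funext i
  exact dotProduct_δ (A i) j

lemma trace_Kminus_field {n : ℕ} {w : Coord n} (hw : w ∈ ball n) (a b : Fin n) :
    ((gap w).adjugate * (mat (symProd (δ a) (δ b)) * (mat w).map (starRingEnd ℂ))).trace =
      ((mat w).map (starRingEnd ℂ) * (gap w).adjugate) a b := by
  rw [trace_mul_symProd_mul _ _ (conj_mul_adjugate_gap_transpose hw), mulVec_δ, dotProduct_comm,
    dotProduct_δ]

lemma trace_Kzero_field {n : ℕ} {w : Coord n} (hw : w ∈ ball n) (a b : Fin n) :
    ((gap w).adjugate * (mat (symProd (mat w a) (δ b)) * (mat w).map (starRingEnd ℂ))).trace =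
      (gap w).adjugate a b - (gap w).det * δ a b := by
  rw [trace_mul_symProd_mul _ _ (conj_mul_adjugate_gap_transpose hw), mulVec_δ]
  change (mat w * ((mat w).map (starRingEnd ℂ) * (gap w).adjugate)) a b = _
  rw [mul_conj_mul_adjugate_gap]
  simp [Matrix.one_apply, δ]

lemma conj_trace_Kplus_field {n : ℕ} {w : Coord n} (hw : w ∈ ball n) (a b : Fin n) :
    starRingEnd ℂ ((gap w).adjugate *
      (mat (symProd (mat w a) (mat w b)) * (mat w).map (starRingEnd ℂ))).trace =
      ((mat w).map (starRingEnd ℂ) * (gap w).adjugate) a b -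
        (gap w).det * starRingEnd ℂ (mat w a b) := by
  have hS := conj_mul_adjugate_gap_transpose hw
  have h1 : mat w a ⬝ᵥ ((mat w).map (starRingEnd ℂ) * (gap w).adjugate) *ᵥ mat w b =
      (mat w * ((mat w).map (starRingEnd ℂ) * (gap w).adjugate) * mat w) a b := by
    have h2 : mat w b = fun l => mat w l b := funext fun l => mat_symm w b l
    rw [h2, Matrix.mul_assoc]
    rfl
  have h3 : starRingEnd ℂ (gap w).det = (gap w).det := by
    rw [det_gap_eq_re, Complex.conj_ofReal]
  rw [trace_mul_symProd_mul _ _ hS, h1, mul_conj_mul_adjugate_gap, Matrix.sub_mul,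
    Matrix.smul_mul, Matrix.one_mul]
  simp only [Matrix.sub_apply, Matrix.smul_apply, smul_eq_mul, map_sub, map_mul, h3]
  congr 1
  rw [← hS, transpose_apply, Matrix.mul_apply, Matrix.mul_apply, map_sum]
  refine Finset.sum_congr rfl fun l _ => ?_
  rw [map_mul, conj_adjugate_gap, Matrix.map_apply, mat_symm w l b, mul_comm]

lemma divg_const {n : ℕ} (V w : Coord n) : divg (fderiv ℂ (fun _ : Coord n => V) w) = 0 := by
  rw [fderiv_fun_const]
  simp [divg, mat_zero]

lemma divg_Kzero_field {n : ℕ} (a b : Fin n) (w : Coord n) :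
    divg (fderiv ℂ (fun w : Coord n => symProd (mat w a) (δ b)) w) = (n + 1) / 2 * δ a b := by
  obtain ⟨L, hL, hL'⟩ := hasFDerivAt_Kzero_field a b w
  rw [hL.fderiv, divg]
  simp only [hL', mat_symProd]
  simp only [δ, add_mul, add_div, div_mul_eq_mul_div, Finset.sum_add_distrib,
    ← Finset.sum_div]
  simp
  by_cases h : a = b
  · subst h; simp; ring
  · simp [h, Ne.symm h]

lemma divg_Kplus_field {n : ℕ} (a b : Fin n) (w : Coord n) :
    divg (fderiv ℂ (fun w : Coord n => symProd (mat w a) (mat w b)) w) = (n + 1) * mat w a b := by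
  obtain ⟨L, hL, hL'⟩ := hasFDerivAt_Kplus_field a b w
  rw [hL.fderiv, divg]
  simp only [hL', mat_add, Matrix.add_apply, mat_symProd]
  simp only [δ, add_mul, add_div, mul_add, div_mul_eq_mul_div, mul_div_assoc',
    Finset.sum_add_distrib, ← Finset.sum_div]
  simp [mat_symm w b a]
  ring

lemma isFormalAdjoint_Kplus {n : ℕ} (k : ℝ) (a b : Fin n) :
    IsFormalAdjoint (expo n k) (fun w => (k : ℂ) / 2 * mat w a b) (fun _ => 0)
      (fun w => symProd (mat w a) (mat w b)) (fun _ => symProd (δ a) (δ b))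
      (fun w => starRingEnd ℂ (mat w a b)) where
  potential w _ := by
    rw [divg_Kplus_field, divg_const]
    have h2 : starRingEnd ℂ 2 = 2 := map_ofNat _ 2
    simp [expo, h2]
    ring
  tangent w hw := by
    rw [trace_Kminus_field hw, conj_trace_Kplus_field hw]
    ring

lemma isFormalAdjoint_Kzero {n : ℕ} (k : ℝ) (a b : Fin n) :
    IsFormalAdjoint (expo n k) (fun _ => (k : ℂ) / 4 * δ a b) (fun _ => (k : ℂ) / 4 * δ b a)
      (fun w => symProd (mat w a) (δ b)) (fun w => symProd (mat w b) (δ a)) (fun _ => 0) where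
  potential w _ := by
    have h : starRingEnd ℂ (δ a b) = δ a b := by simp [δ]
    rw [divg_Kzero_field, divg_Kzero_field]
    have h2 : starRingEnd ℂ 2 = 2 := map_ofNat _ 2
    have h4 : starRingEnd ℂ 4 = 4 := map_ofNat _ 4
    simp [h, h2, h4, δ_comm b a]
  tangent w hw := by
    have h : starRingEnd ℂ (δ a b) = δ a b := by simp [δ]
    have h3 : starRingEnd ℂ (gap w).det = (gap w).det := by
      rw [det_gap_eq_re, Complex.conj_ofReal]
    rw [trace_Kzero_field hw, trace_Kzero_field hw, map_sub, map_mul, h3, h, conj_adjugate_gap,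
      δ_comm b a]
    ring

/-! ### The adjoint relation on maximal domains -/

lemma weight_pos {n : ℕ} (k : ℝ) {w : Coord n} (hw : w ∈ ball n) : 0 < weight k w :=
  Real.rpow_pos_of_pos (det_gap_pos hw) _

lemma continuousOn_weight {n : ℕ} (k : ℝ) : ContinuousOn (weight (n := n) k) (ball n) :=
  continuous_det_gap.continuousOn.rpow_const fun _ hw => Or.inl (det_gap_pos hw).ne'

lemma continuousOn_weight_complex {n : ℕ} (k : ℝ) :
    ContinuousOn (fun w => (weight (n := n) k w : ℂ)) (ball n) :=
  Complex.continuous_ofReal.comp_continuousOn (continuousOn_weight k)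

lemma integrableOn_conj_mul_weight {n : ℕ} {k : ℝ} {f g : Coord n → ℂ} (hf : f ∈ Bergman n k)
    (hg : g ∈ Bergman n k) :
    IntegrableOn (fun w => starRingEnd ℂ (f w) * g w * (weight k w : ℂ)) (ball n) := by
  have hm := isOpen_ball (n := n).measurableSet
  refine Integrable.mono' (hf.2.add hg.2) ?_ ?_
  · exact (((continuousOn_conj hf.1.continuousOn).mul hg.1.continuousOn).mul
      (continuousOn_weight_complex k)).aestronglyMeasurable hm
  · refine (ae_restrict_iff' hm).2 (ae_of_all _ fun w hw => ?_)
    have hp := weight_pos k hw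
    rw [norm_mul, norm_mul, RCLike.norm_conj, Complex.norm_real, Real.norm_of_nonneg hp.le,
      Pi.add_apply, ← add_mul]
    gcongr
    nlinarith [sq_nonneg (‖f w‖ - ‖g w‖), sq_nonneg ‖f w‖, sq_nonneg ‖g w‖]

/-- The adjoint relation for formally adjoint operators, without any growth condition on the
derivatives beyond square integrability of `T f` and `S g = h`: since the field is tangent to the
boundary, the error made by truncating the weight is bounded by a multiple of the weight. -/
lemma innerProd_eq_of_isFormalAdjoint {n : ℕ} {k : ℝ} {α β m : Coord n → ℂ}
    {X Y : Coord n → Coord n} (hα : Continuous α) (hβ : Continuous β) (hX : ContDiff ℂ 1 X)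
    (hY : ContDiff ℂ 1 Y) (h : IsFormalAdjoint (expo n k) α β X Y m) (hm : Continuous m)
    (hm1 : ∀ w ∈ ball n, ‖m w‖ ≤ 1) {f g u : Coord n → ℂ} (hf : f ∈ maxDomain k (diffOp α X))
    (hg : g ∈ Bergman n k) (hu : u ∈ Bergman n k) (hug : Set.EqOn u (diffOp β Y g) (ball n)) :
    innerProd k (diffOp α X f) g = innerProd k f u := by
  have hmeas := isOpen_ball (n := n).measurableSet
  set T := diffOp α X f with hT
  set q := expo n k
  have i1 := integrableOn_conj_mul_weight hf.2 hg
  have i2 := integrableOn_conj_mul_weight hf.1 hu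
  have i3 := integrableOn_conj_mul_weight hf.1 hg
  have hcl : ContinuousOn (fun w => starRingEnd ℂ (T w) * g w - starRingEnd ℂ (f w) * u w)
      (ball n) :=
    ((continuousOn_conj hf.2.1.continuousOn).mul hg.1.continuousOn).sub
      ((continuousOn_conj hf.1.1.continuousOn).mul hu.1.continuousOn)
  have l1 : Tendsto (fun ε => ∫ w in ball n,
      (starRingEnd ℂ (T w) * g w - starRingEnd ℂ (f w) * u w) * testFn q ε w) (𝓝[>] 0)
      (𝓝 (∫ w in ball n, (starRingEnd ℂ (T w) * g w - starRingEnd ℂ (f w) * u w) *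
        (weight k w : ℂ))) := by
    refine tendsto_integral_filter_of_dominated_convergence
      (fun w => ‖(starRingEnd ℂ (T w) * g w - starRingEnd ℂ (f w) * u w) * (weight k w : ℂ)‖)
      ?_ ?_ ?_ ?_
    · exact Eventually.of_forall fun ε =>
        (hcl.mul (contDiffOn_testFn q ε).continuousOn).aestronglyMeasurable hmeas
    · filter_upwards [self_mem_nhdsWithin] with ε hε
      refine (ae_restrict_iff' hmeas).2 (ae_of_all _ fun w hw => ?_)
      rw [norm_mul, norm_mul]
      gcongr
      rw [testFn, Complex.norm_real, Complex.norm_real, Real.norm_of_nonneg (weight_pos k hw).le]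
      exact abs_cutoff_le q (le_of_lt hε) (det_gap_pos hw)
    · refine (i1.sub i2).norm.congr (ae_of_all _ fun w => ?_)
      simp only [hT, Pi.sub_apply, sub_mul]
    · refine (ae_restrict_iff' hmeas).2 (ae_of_all _ fun w hw => ?_)
      exact ((Complex.continuous_ofReal.tendsto _).comp
        (tendsto_cutoff q (det_gap_pos hw))).const_mul _
  have l2 : Tendsto (fun ε => ∫ w in ball n, starRingEnd ℂ (f w) * g w * m w *
      (cutoffDefect q ε (gap w).det.re : ℝ)) (𝓝[>] 0) (𝓝 (∫ w in ball n, (0 : ℂ))) := by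
    refine tendsto_integral_filter_of_dominated_convergence
      (fun w => 2 * ‖starRingEnd ℂ (f w) * g w * (weight k w : ℂ)‖) ?_ ?_ (i3.norm.const_mul 2) ?_
    · filter_upwards [self_mem_nhdsWithin] with ε hε
      have hc : ContinuousOn (fun w : Coord n => cutoffDefect q ε (gap w).det.re) (ball n) := by
        unfold cutoffDefect
        have hD := continuous_det_gap (n := n)
        have hP : ContinuousOn (fun w : Coord n => (gap w).det.re ^ (q - 2)) (ball n) :=
          hD.continuousOn.rpow_const fun _ hw => Or.inl (det_gap_pos hw).ne'
        have hM : Continuous fun w : Coord n => max ((gap w).det.re - ε) 0 :=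
          (hD.sub continuous_const).max continuous_const
        exact ((continuousOn_const.mul hP).mul hM.continuousOn).mul (hM.sub hD).continuousOn
      exact ((((continuousOn_conj hf.1.1.continuousOn).mul hg.1.continuousOn).mul
        hm.continuousOn).mul (Complex.continuous_ofReal.comp_continuousOn hc)).aestronglyMeasurable
        hmeas
    · filter_upwards [self_mem_nhdsWithin] with ε hε
      refine (ae_restrict_iff' hmeas).2 (ae_of_all _ fun w hw => ?_)
      have h1 := abs_cutoffDefect_le q (le_of_lt hε) (det_gap_pos hw)
      rw [norm_mul, norm_mul _ (m w), norm_mul _ ((weight k w : ℝ) : ℂ), Complex.norm_real,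
        Complex.norm_real, Real.norm_of_nonneg (weight_pos k hw).le, Real.norm_eq_abs]
      calc ‖starRingEnd ℂ (f w) * g w‖ * ‖m w‖ * |cutoffDefect q ε (gap w).det.re|
          ≤ ‖starRingEnd ℂ (f w) * g w‖ * 1 * (2 * (gap w).det.re ^ q) := by
            gcongr
            exact hm1 w hw
        _ = 2 * (‖starRingEnd ℂ (f w) * g w‖ * weight k w) := by rw [weight]; ring
    · refine (ae_restrict_iff' hmeas).2 (ae_of_all _ fun w hw => ?_)
      simpa using ((Complex.continuous_ofReal.tendsto _).comp
        (tendsto_cutoffDefect q (det_gap_pos hw))).const_mul (starRingEnd ℂ (f w) * g w * m w)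
  have heq : (fun ε => ∫ w in ball n,
      (starRingEnd ℂ (T w) * g w - starRingEnd ℂ (f w) * u w) * testFn q ε w) =ᶠ[𝓝[>] 0]
      fun ε => ∫ w in ball n, starRingEnd ℂ (f w) * g w * m w *
        (cutoffDefect q ε (gap w).det.re : ℝ) := by
    filter_upwards [self_mem_nhdsWithin] with ε hε
    rw [← integral_truncated_adjoint hε hα hβ hX hY h hf.1.1 hg.1]
    refine setIntegral_congr_fun hmeas fun w hw => ?_
    simp only [hT, hug hw]
  have hlim := tendsto_nhds_unique (l1.congr' heq) l2
  rw [integral_zero] at hlim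
  simp only [sub_mul] at hlim
  have hsub := integral_sub i1 i2
  rw [hlim] at hsub
  rw [innerProd, innerProd, sub_eq_zero.1 hsub.symm]

lemma contDiff_Kzero_field {n : ℕ} (a b : Fin n) :
    ContDiff ℂ 1 fun w : Coord n => symProd (mat w a) (δ b) :=
  ((symProd.toContinuousBilinearMap.flip (δ b)).comp (rowCLM a)).contDiff

lemma contDiff_Kplus_field {n : ℕ} (a b : Fin n) :
    ContDiff ℂ 1 fun w : Coord n => symProd (mat w a) (mat w b) :=
  (analyticOnNhd_bilinear symProd.toContinuousBilinearMap ((rowCLM a).analyticOnNhd Set.univ)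
    ((rowCLM b).analyticOnNhd Set.univ)).contDiff

lemma innerProd_Kplus {n : ℕ} {k : ℝ} (a b : Fin n) {f g u : Coord n → ℂ}
    (hf : f ∈ maxDomain k (Kplus (fun _ => k) a b)) (hg : g ∈ Bergman n k) (hu : u ∈ Bergman n k)
    (hug : Set.EqOn u (Kminus a b g) (ball n)) :
    innerProd k (Kplus (fun _ => k) a b f) g = innerProd k f u := by
  rw [Kplus_eq_diffOp] at hf ⊢
  rw [Kminus_eq_diffOp] at hug
  refine innerProd_eq_of_isFormalAdjoint (continuous_const.mul (entryCLM a b).continuous)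
    continuous_const (contDiff_Kplus_field a b) contDiff_const (isFormalAdjoint_Kplus k a b)
    (Complex.continuous_conj.comp (entryCLM a b).continuous) (fun w hw => ?_) hf hg hu hug
  rw [RCLike.norm_conj]
  exact norm_apply_le_one hw _

lemma innerProd_Kzero {n : ℕ} {k : ℝ} (a b : Fin n) {f g u : Coord n → ℂ}
    (hf : f ∈ maxDomain k (Kzero (fun _ => k) a b)) (hg : g ∈ Bergman n k) (hu : u ∈ Bergman n k)
    (hug : Set.EqOn u (Kzero (fun _ => k) b a g) (ball n)) :
    innerProd k (Kzero (fun _ => k) a b f) g = innerProd k f u := by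
  rw [Kzero_eq_diffOp] at hf hug ⊢
  exact innerProd_eq_of_isFormalAdjoint continuous_const continuous_const
    (contDiff_Kzero_field a b) (contDiff_Kzero_field b a) (isFormalAdjoint_Kzero k a b)
    continuous_const (fun w _ => by simp) hf hg hu hug

/-! ### Rotations and dilations -/

lemma measurePreserving_smul {n : ℕ} {c : ℂ} (hc : ‖c‖ = 1) :
    MeasurePreserving (fun w : Coord n => c • w) volume volume := by
  have h : MeasurePreserving (fun z : ℂ => c * z) volume volume := by
    have h1 := (rotation ⟨c, mem_sphere_zero_iff_norm.2 hc⟩).measurePreserving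
    exact h1
  exact volume_preserving_pi fun _ => h

lemma measurableEmbedding_smul {n : ℕ} {c : ℂ} (hc : ‖c‖ = 1) :
    MeasurableEmbedding (fun w : Coord n => c • w) :=
  (Homeomorph.smulOfNeZero c (fun h => by simp [h] at hc)).measurableEmbedding

lemma weight_smul {n : ℕ} (k : ℝ) {c : ℂ} (hc : ‖c‖ = 1) (w : Coord n) :
    weight k (c • w) = weight k w := by
  rw [weight, gap_smul hc, weight]

lemma setIntegral_comp_smul {n : ℕ} {E : Type*} [NormedAddCommGroup E] [NormedSpace ℝ E] {c : ℂ}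
    (hc : ‖c‖ = 1) (F : Coord n → E) :
    ∫ w in ball n, F (c • w) = ∫ w in ball n, F w := by
  have h := (measurePreserving_smul (n := n) hc).setIntegral_preimage_emb
    (measurableEmbedding_smul hc) F (ball n)
  have h2 : (fun w : Coord n => c • w) ⁻¹' ball n = ball n :=
    Set.ext fun w => smul_mem_ball_iff hc
  rwa [h2] at h

lemma integrableOn_comp_smul {n : ℕ} {E : Type*} [NormedAddCommGroup E] {c : ℂ}
    (hc : ‖c‖ = 1) {F : Coord n → E} (hF : IntegrableOn F (ball n)) :
    IntegrableOn (fun w => F (c • w)) (ball n) := by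
  have h := ((measurePreserving_smul (n := n) hc).integrableOn_comp_preimage
    (measurableEmbedding_smul hc) (s := ball n)).2 hF
  have h2 : (fun w : Coord n => c • w) ⁻¹' ball n = ball n :=
    Set.ext fun w => smul_mem_ball_iff hc
  rwa [h2] at h

/-- The dilate `w ↦ f (r w)`. -/
noncomputable def dil {n : ℕ} (r : ℝ) : Op n := fun f w => f ((r : ℂ) • w)

lemma norm_ofReal_le {r : ℝ} (h0 : 0 ≤ r) (h1 : r ≤ 1) : ‖(r : ℂ)‖ ≤ 1 := by
  rwa [Complex.norm_real, Real.norm_of_nonneg h0]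

lemma isHol_comp_smul {n : ℕ} {f : Coord n → ℂ} (hf : IsHol f) {c : ℂ} (hc : ‖c‖ ≤ 1) :
    IsHol fun w => f (c • w) := fun w hw =>
  AnalyticAt.fun_comp (g := f) (hf _ (smul_mem_ball hc hw))
    ((c • ContinuousLinearMap.id ℂ (Coord n)).analyticAt w)

lemma isHol_dil {n : ℕ} {f : Coord n → ℂ} (hf : IsHol f) {r : ℝ} (h0 : 0 ≤ r) (h1 : r ≤ 1) :
    IsHol (dil r f) := isHol_comp_smul hf (norm_ofReal_le h0 h1)

/-- The pairing of `f` with the rotate of `g` by `c`, up to the normalising constant. -/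
noncomputable def rotPairing {n : ℕ} (k : ℝ) (f g : Coord n → ℂ) (c : ℂ) : ℂ :=
  ∫ w in ball n, starRingEnd ℂ (f w) * g (c • w) * (weight k w : ℂ)

lemma conj_rotPairing {n : ℕ} (k : ℝ) (f g : Coord n → ℂ) {c : ℂ} (hc : ‖c‖ = 1) :
    starRingEnd ℂ (rotPairing k f g c) = rotPairing k g f (starRingEnd ℂ c) := by
  rw [rotPairing, ← integral_conj, rotPairing,
    ← setIntegral_comp_smul hc (F := fun w => starRingEnd ℂ (g w) *
      f (starRingEnd ℂ c • w) * (weight k w : ℂ))]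
  have h : starRingEnd ℂ c * c = 1 := by
    rw [Complex.conj_mul', hc]; simp
  congr 1
  funext w
  simp only [map_mul, Complex.conj_conj, Complex.conj_ofReal, smul_smul, h, one_smul,
    weight_smul k hc]
  ring

/-- The Cauchy kernel on the unit circle. -/
noncomputable def cauchyKer (r θ : ℝ) : ℂ := (circleMap 0 1 θ - r)⁻¹ * circleMap 0 1 θ

lemma circleMap_sub_ne_zero {r : ℝ} (h0 : 0 ≤ r) (h1 : r < 1) (θ : ℝ) :
    circleMap 0 1 θ - (r : ℂ) ≠ 0 := by
  intro h
  have h2 := congrArg norm (sub_eq_zero.1 h)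
  rw [norm_circleMap_zero, Complex.norm_real, Real.norm_of_nonneg h0, abs_one] at h2
  linarith

lemma continuous_cauchyKer {r : ℝ} (h0 : 0 ≤ r) (h1 : r < 1) : Continuous (cauchyKer r) :=
  (((continuous_circleMap 0 1).sub continuous_const).inv₀
    (circleMap_sub_ne_zero h0 h1)).mul (continuous_circleMap 0 1)

lemma circleMap_two_pi_sub (θ : ℝ) :
    circleMap 0 1 (2 * Real.pi - θ) = starRingEnd ℂ (circleMap 0 1 θ) := by
  simp only [circleMap, Complex.ofReal_one, one_mul, zero_add, ← Complex.exp_conj, map_mul,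
    Complex.conj_ofReal, Complex.conj_I]
  rw [Complex.exp_eq_exp_iff_exists_int]
  exact ⟨1, by push_cast; ring⟩

lemma cauchyKer_two_pi_sub (r θ : ℝ) :
    cauchyKer r (2 * Real.pi - θ) = starRingEnd ℂ (cauchyKer r θ) := by
  simp only [cauchyKer, circleMap_two_pi_sub, map_mul, map_inv₀, map_sub, Complex.conj_ofReal]

/-- Cauchy's formula at the point `r` for `z ↦ g (z w)`. It is used on the unit circle itself, so
that the dilates of `g` are averages of rotates of `g`. -/
lemma integral_cauchyKer {n : ℕ} {g : Coord n → ℂ} (hg : IsHol g) {r : ℝ} (h0 : 0 ≤ r)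
    (h1 : r < 1) {w : Coord n} (hw : w ∈ ball n) :
    ∫ θ in (0 : ℝ)..2 * Real.pi, cauchyKer r θ * g (circleMap 0 1 θ • w) =
      2 * Real.pi * dil r g w := by
  have hd : DifferentiableOn ℂ (fun z : ℂ => g (z • w)) (Metric.closedBall 0 1) := by
    intro z hz
    have hz' : ‖z‖ ≤ 1 := by simpa using hz
    refine DifferentiableAt.differentiableWithinAt ?_
    exact DifferentiableAt.comp z (g := g)
      (differentiableAt_of_isHol hg (smul_mem_ball hz' hw))
      (differentiableAt_id.smul_const w)
  have hr : (r : ℂ) ∈ Metric.ball (0 : ℂ) 1 := by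
    rw [mem_ball_zero_iff, Complex.norm_real, Real.norm_of_nonneg h0]; exact h1
  have h := hd.circleIntegral_sub_inv_smul hr
  rw [circleIntegral] at h
  have h2 : ∀ θ : ℝ, deriv (circleMap 0 1) θ • (circleMap 0 1 θ - (r : ℂ))⁻¹ •
      g (circleMap 0 1 θ • w) = Complex.I * (cauchyKer r θ * g (circleMap 0 1 θ • w)) := by
    intro θ
    rw [deriv_circleMap, cauchyKer, smul_eq_mul, smul_eq_mul]
    ring
  have h3 : Complex.I * (∫ θ in (0 : ℝ)..2 * Real.pi,
      cauchyKer r θ * g (circleMap 0 1 θ • w)) = Complex.I * (2 * Real.pi * dil r g w) := by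
    rw [← intervalIntegral.integral_const_mul, ← funext h2, h, dil, smul_eq_mul]
    ring
  exact mul_left_cancel₀ Complex.I_ne_zero h3

lemma norm_circleMap_one (θ : ℝ) : ‖circleMap 0 1 θ‖ = 1 := by
  rw [norm_circleMap_zero, abs_one]

lemma integrable_rot {n : ℕ} {k : ℝ} {f g : Coord n → ℂ} (hf : f ∈ Bergman n k)
    (hg : g ∈ Bergman n k) {r : ℝ} (h0 : 0 ≤ r) (h1 : r < 1) :
    Integrable (Function.uncurry fun (θ : ℝ) (w : Coord n) =>
      cauchyKer r θ * (starRingEnd ℂ (f w) * g (circleMap 0 1 θ • w) * (weight k w : ℂ)))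
      ((volume.restrict (Set.uIoc 0 (2 * Real.pi))).prod (volume.restrict (ball n))) := by
  have hmeas := isOpen_ball (n := n).measurableSet
  obtain ⟨C, hC⟩ : ∃ C, ∀ θ, ‖cauchyKer r θ‖ ≤ C := by
    have hper : Function.Periodic (cauchyKer r) (2 * Real.pi) := fun θ => by
      simp only [cauchyKer, periodic_circleMap 0 1 θ]
    obtain ⟨C, hC⟩ := (isCompact_Icc (a := (0 : ℝ)) (b := 2 * Real.pi)).exists_bound_of_continuousOn
      (continuous_cauchyKer h0 h1).continuousOn
    refine ⟨C, fun θ => ?_⟩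
    obtain ⟨y, hy, hy'⟩ := hper.exists_mem_Ico₀ Real.two_pi_pos θ
    rw [hy']
    exact hC y ⟨hy.1, hy.2.le⟩
  have : IsFiniteMeasure (volume.restrict (Set.uIoc 0 (2 * Real.pi))) := by
    rw [Set.uIoc_of_le Real.two_pi_pos.le]; infer_instance
  have hC0 : 0 ≤ C := (norm_nonneg _).trans (hC 0)
  -- The integrand is dominated by `|f|² ρ` plus the rotates of `|g|² ρ`, up to the bound `C` of
  -- the kernel.
  have m1 : Integrable (fun p : ℝ × Coord n => ‖f p.2‖ ^ 2 * weight k p.2)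
      ((volume.restrict (Set.uIoc 0 (2 * Real.pi))).prod (volume.restrict (ball n))) := by
    have := (integrable_const (1 : ℝ) (μ := volume.restrict (Set.uIoc 0 (2 * Real.pi)))).mul_prod
      hf.2
    simpa using this
  have hcont : ∀ {F : Coord n → ℂ}, ContinuousOn F (ball n) →
      ContinuousOn (fun p : ℝ × Coord n => F (circleMap 0 1 p.1 • p.2))
        (Set.uIoc 0 (2 * Real.pi) ×ˢ ball n) := by
    intro F hF
    refine hF.comp (((continuous_circleMap 0 1).comp continuous_fst).smul
      continuous_snd).continuousOn fun p hp => ?_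
    exact (smul_mem_ball_iff (norm_circleMap_one p.1)).2 hp.2
  have hwt : ContinuousOn (fun p : ℝ × Coord n => weight k p.2)
        (Set.uIoc 0 (2 * Real.pi) ×ˢ ball n) :=
    (continuousOn_weight k).comp continuous_snd.continuousOn fun p hp => hp.2
  have hprod := measurableSet_uIoc (a := (0 : ℝ)) (b := 2 * Real.pi).prod hmeas
  have m2 : Integrable (fun p : ℝ × Coord n =>
      ‖g (circleMap 0 1 p.1 • p.2)‖ ^ 2 * weight k p.2)
      ((volume.restrict (Set.uIoc 0 (2 * Real.pi))).prod (volume.restrict (ball n))) := by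
    have hrot : ∀ θ : ℝ, (fun w : Coord n => ‖g (circleMap 0 1 θ • w)‖ ^ 2 * weight k w) =
        fun w => (fun w => ‖g w‖ ^ 2 * weight k w) (circleMap 0 1 θ • w) := fun θ => by
      funext w; simp only [weight_smul k (norm_circleMap_one θ)]
    have hsm : AEStronglyMeasurable (fun p : ℝ × Coord n =>
        ‖g (circleMap 0 1 p.1 • p.2)‖ ^ 2 * weight k p.2)
        ((volume.restrict (Set.uIoc 0 (2 * Real.pi))).prod (volume.restrict (ball n))) := by
      rw [Measure.prod_restrict]
      exact (((hcont hg.1.continuousOn).norm.pow 2).mul hwt).aestronglyMeasurable hprod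
    refine (integrable_prod_iff hsm).2 ⟨ae_of_all _ fun θ => ?_, ?_⟩
    · change IntegrableOn (fun w : Coord n => ‖g (circleMap 0 1 θ • w)‖ ^ 2 * weight k w) (ball n)
      rw [hrot]
      exact integrableOn_comp_smul (norm_circleMap_one θ) hg.2
    · have : (fun θ : ℝ => ∫ w in ball n, ‖‖g (circleMap 0 1 θ • w)‖ ^ 2 * weight k w‖) =
          fun _ => ∫ w in ball n, ‖‖g w‖ ^ 2 * weight k w‖ := by
        funext θ
        have h2 := setIntegral_comp_smul (norm_circleMap_one θ)
          fun w : Coord n => ‖‖g w‖ ^ 2 * weight k w‖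
        simpa only [weight_smul k (norm_circleMap_one θ)] using h2
      simp only [this]
      exact integrable_const _
  refine Integrable.mono' ((m1.add m2).const_mul C) ?_ ?_
  · rw [Measure.prod_restrict]
    refine ContinuousOn.aestronglyMeasurable ?_ hprod
    refine ((continuous_cauchyKer h0 h1).comp continuous_fst).continuousOn.mul ?_
    refine (ContinuousOn.mul ?_ (hcont hg.1.continuousOn)).mul
      (Complex.continuous_ofReal.comp_continuousOn hwt)
    exact (continuousOn_conj hf.1.continuousOn).comp continuous_snd.continuousOn fun p hp => hp.2
  · rw [Measure.prod_restrict]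
    refine (ae_restrict_iff' hprod).2 (ae_of_all _ fun p hp => ?_)
    have hpos := weight_pos k hp.2
    simp only [Function.uncurry, Pi.add_apply]
    rw [norm_mul, norm_mul, norm_mul, RCLike.norm_conj, Complex.norm_real,
      Real.norm_of_nonneg hpos.le, ← add_mul]
    refine mul_le_mul (hC _) ?_ (by positivity) hC0
    gcongr
    nlinarith [sq_nonneg (‖f p.2‖ - ‖g (circleMap 0 1 p.1 • p.2)‖), sq_nonneg ‖f p.2‖,
      sq_nonneg ‖g (circleMap 0 1 p.1 • p.2)‖]

lemma integral_conj_mul_dil {n : ℕ} {k : ℝ} {f g : Coord n → ℂ} (hf : f ∈ Bergman n k)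
    (hg : g ∈ Bergman n k) {r : ℝ} (h0 : 0 ≤ r) (h1 : r < 1) :
    2 * Real.pi * ∫ w in ball n, starRingEnd ℂ (f w) * dil r g w * (weight k w : ℂ) =
      ∫ θ in (0 : ℝ)..2 * Real.pi, cauchyKer r θ * rotPairing k f g (circleMap 0 1 θ) := by
  have hmeas := isOpen_ball (n := n).measurableSet
  have h := intervalIntegral_integral_swap (integrable_rot hf hg h0 h1)
  simp only [rotPairing]
  simp only [integral_const_mul] at h
  rw [h, ← integral_const_mul]
  refine setIntegral_congr_fun hmeas fun w hw => ?_
  have h2 := integral_cauchyKer hg.1 h0 h1 hw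
  calc (2 * Real.pi * (starRingEnd ℂ (f w) * dil r g w * (weight k w : ℂ)) : ℂ)
      = (starRingEnd ℂ (f w) * (weight k w : ℂ)) * (2 * Real.pi * dil r g w) := by ring
    _ = _ := by
      rw [← h2, ← intervalIntegral.integral_const_mul]
      congr 1
      funext θ
      ring

/-- Dilations are self-adjoint. Both pairings are averages of the rotated pairings against the
Cauchy kernel, one being the reflection of the other. -/
lemma innerProd_dil {n : ℕ} {k : ℝ} {f g : Coord n → ℂ} (hf : f ∈ Bergman n k)
    (hg : g ∈ Bergman n k) {r : ℝ} (h0 : 0 ≤ r) (h1 : r < 1) :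
    innerProd k (dil r f) g = innerProd k f (dil r g) := by
  have e1 := integral_conj_mul_dil hf hg h0 h1
  have e2 := congrArg (starRingEnd ℂ) (integral_conj_mul_dil hg hf h0 h1)
  have e3 : starRingEnd ℂ (∫ θ in (0 : ℝ)..2 * Real.pi,
      cauchyKer r θ * rotPairing k g f (circleMap 0 1 θ)) =
      ∫ θ in (0 : ℝ)..2 * Real.pi, cauchyKer r θ * rotPairing k f g (circleMap 0 1 θ) := by
    have e4 := intervalIntegral.integral_comp_sub_left
      (fun θ => cauchyKer r θ * rotPairing k f g (circleMap 0 1 θ)) (2 * Real.pi)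
      (a := 0) (b := 2 * Real.pi)
    rw [sub_self, sub_zero] at e4
    rw [← e4, intervalIntegral.integral_of_le Real.two_pi_pos.le,
      intervalIntegral.integral_of_le Real.two_pi_pos.le, ← integral_conj]
    congr 1
    funext θ
    rw [map_mul, conj_rotPairing k g f (norm_circleMap_one θ), cauchyKer_two_pi_sub,
      circleMap_two_pi_sub]
  rw [e3, ← e1, map_mul, ← integral_conj] at e2
  have h2pi : starRingEnd ℂ (2 * Real.pi : ℂ) = 2 * Real.pi := by
    rw [map_mul, Complex.conj_ofReal, map_ofNat]
  rw [h2pi] at e2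
  have hpi : (2 * Real.pi : ℂ) ≠ 0 := by
    simp [Real.pi_ne_zero]
  have e5 := mul_left_cancel₀ hpi e2
  rw [innerProd, innerProd, ← e5]
  congr 2
  funext w
  simp only [map_mul, Complex.conj_conj, Complex.conj_ofReal]
  ring

/-! ### From formal adjoints to adjoints -/

lemma innerProd_congr {n : ℕ} (k : ℝ) {f f' g g' : Coord n → ℂ} (hf : Set.EqOn f f' (ball n))
    (hg : Set.EqOn g g' (ball n)) : innerProd k f g = innerProd k f' g' := by
  rw [innerProd, innerProd]
  congr 1
  refine setIntegral_congr_fun isOpen_ball.measurableSet fun w hw => ?_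
  simp only [hf hw, hg hw]

lemma innerProd_smul_left {n : ℕ} (k t : ℝ) (f g : Coord n → ℂ) :
    innerProd k (fun w => (t : ℂ) * f w) g = t * innerProd k f g := by
  rw [innerProd, innerProd, ← integral_const_mul, ← integral_const_mul, ← integral_const_mul]
  congr 1
  funext w
  rw [map_mul, Complex.conj_ofReal]
  ring

lemma innerProd_smul_right {n : ℕ} (k t : ℝ) (f g : Coord n → ℂ) :
    innerProd k f (fun w => (t : ℂ) * g w) = t * innerProd k f g := by
  rw [innerProd, innerProd, ← integral_const_mul, ← integral_const_mul, ← integral_const_mul]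
  congr 1
  funext w
  ring

lemma mem_bergman_congr {n : ℕ} {k : ℝ} {f g : Coord n → ℂ} (hg : IsHol g)
    (h : Set.EqOn g f (ball n)) (hf : f ∈ Bergman n k) : g ∈ Bergman n k := by
  refine ⟨hg, hf.2.congr_fun (fun w hw => ?_) isOpen_ball.measurableSet⟩
  simp only [h hw]

lemma mul_mem_bergman {n : ℕ} {k : ℝ} (c : ℂ) {f : Coord n → ℂ} (hf : f ∈ Bergman n k) :
    (fun w => c * f w) ∈ Bergman n k := by
  refine ⟨analyticOnNhd_const.mul hf.1, ?_⟩
  refine (hf.2.const_mul (‖c‖ ^ 2)).congr (ae_of_all _ fun w => ?_)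
  simp only [norm_mul]; ring

/-- A dilate by `r < 1` of any holomorphic function is bounded on the ball, hence square
integrable as soon as the weight is integrable. -/
lemma dil_mem_bergman {n : ℕ} {k : ℝ} (hint : IntegrableOn (weight (n := n) k) (ball n))
    {f : Coord n → ℂ} (hf : IsHol f) {r : ℝ} (h0 : 0 ≤ r) (h1 : r < 1) :
    dil r f ∈ Bergman n k := by
  have hm := isOpen_ball (n := n).measurableSet
  have hd := isHol_dil hf h0 h1.le
  obtain ⟨C, hC⟩ := (isCompact_opr_le (n := n) r).exists_bound_of_continuousOn
    (hf.continuousOn.mono fun w hw => mem_ball_iff.2 (lt_of_le_of_lt hw h1))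
  refine ⟨hd, Integrable.mono' (hint.const_mul (C ^ 2)) ?_ ?_⟩
  · exact ((hd.continuousOn.norm.pow 2).mul (continuousOn_weight k)).aestronglyMeasurable hm
  · refine (ae_restrict_iff' hm).2 (ae_of_all _ fun w hw => ?_)
    have hp := weight_pos k hw
    rw [Real.norm_of_nonneg (by positivity)]
    gcongr
    refine hC _ ?_
    change ‖opr ((r : ℂ) • w)‖ ≤ r
    rw [map_smul, norm_smul, Complex.norm_real, Real.norm_of_nonneg h0]
    exact mul_le_of_le_one_right h0 (mem_ball_iff.1 hw).le

lemma eqOn_zero_of_innerProd_self {n : ℕ} {k : ℝ} (hJ : huaJ n (expo n k) ≠ 0)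
    {f : Coord n → ℂ} (hf : f ∈ Bergman n k) (h : innerProd k f f = 0) :
    Set.EqOn f 0 (ball n) := by
  have hm := isOpen_ball (n := n).measurableSet
  rw [innerProd, mul_eq_zero] at h
  have h1 := h.resolve_left (by simpa using hJ)
  have h2 : ∀ w, starRingEnd ℂ (f w) * f w * (weight k w : ℂ) =
      ((‖f w‖ ^ 2 * weight k w : ℝ) : ℂ) := by
    intro w
    rw [Complex.conj_mul']
    push_cast
    rfl
  simp only [h2, integral_complex_ofReal, Complex.ofReal_eq_zero] at h1
  rw [setIntegral_eq_zero_iff_of_nonneg_ae ?_ hf.2] at h1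
  · have h3 := Measure.eqOn_open_of_ae_eq h1 isOpen_ball
      ((hf.1.continuousOn.norm.pow 2).mul (continuousOn_weight k)) continuousOn_const
    intro w hw
    have h4 := h3 hw
    simpa [(weight_pos k hw).ne'] using h4
  · refine (ae_restrict_iff' hm).2 (ae_of_all _ fun w hw => ?_)
    have hp := weight_pos k hw
    simp only [Pi.zero_apply]
    positivity

lemma huaJ_ne_zero {n : ℕ} {p : ℝ} (hp : -1 < p) : huaJ n p ≠ 0 := by
  refine (mul_pos (by positivity) (Finset.prod_pos fun i hi => ?_)).ne'
  obtain ⟨hi1, hi2⟩ := Finset.mem_Icc.1 hi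
  have h1 : (1 : ℝ) ≤ i := by exact_mod_cast hi1
  have h2 : (i : ℝ) ≤ n := by exact_mod_cast hi2
  exact div_pos (Real.Gamma_pos_of_pos (by linarith)) (Real.Gamma_pos_of_pos (by linarith))

/-- `T` scales by `t` and `S` by `t⁻¹` under the dilation by `r`. -/
def ScaleInversely {n : ℕ} (T S : Op n) (r t : ℝ) : Prop :=
  (∀ u, IsHol u → ∀ w ∈ ball n, dil r (T u) w = t * T (dil r u) w) ∧
    ∀ u, IsHol u → ∀ w ∈ ball n, t * dil r (S u) w = S (dil r u) w

/-- If `(T f, g) = (f, S g)` whenever both sides make sense, then `S` is the adjoint of `T`.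
Testing the adjoint relation for `(g, h)` against dilates, the self-adjointness of dilations and
the scaling of `T` and `S` show that the dilates of `S g - h` are orthogonal to themselves. -/
lemma hasAdjoint_of_scaleInversely {n : ℕ} {k : ℝ}
    (hint : IntegrableOn (weight (n := n) k) (ball n)) (hJ : huaJ n (expo n k) ≠ 0) {T S : Op n}
    (hT : PreservesHol T) (hS : PreservesHol S)
    (hscale : ∀ r : ℝ, 0 < r → r < 1 → ∃ t : ℝ, t ≠ 0 ∧ ScaleInversely T S r t)
    (hadj : ∀ f ∈ maxDomain k T, ∀ g ∈ Bergman n k, ∀ u ∈ Bergman n k,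
      Set.EqOn u (S g) (ball n) → innerProd k (T f) g = innerProd k f u) :
    HasAdjoint k T S := by
  intro g hg h hh
  refine ⟨fun H => ?_, fun H f hf => hadj f hf g hg h hh H⟩
  have hSg : IsHol (S g) := hS g hg.1
  set u : Coord n → ℂ := fun w => S g w - h w with hu
  have huhol : IsHol u := hSg.sub hh.1
  have key : ∀ r : ℝ, 0 < r → r < 1 → Set.EqOn (dil r u) 0 (ball n) := by
    intro r h0 h1
    obtain ⟨t, ht, hTs, hSs⟩ := hscale r h0 h1
    have htc : (t : ℂ) ≠ 0 := by exact_mod_cast ht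
    have hB : ∀ {v : Coord n → ℂ}, IsHol v → dil r v ∈ Bergman n k := fun hv =>
      dil_mem_bergman hint hv h0.le h1
    have hdom : ∀ {v : Coord n → ℂ}, IsHol v → dil r v ∈ maxDomain k T := by
      intro v hv
      refine ⟨hB hv, mem_bergman_congr (hT _ (hB hv).1) (fun w hw => ?_)
        (mul_mem_bergman (t : ℂ)⁻¹ (hB (hT v hv)))⟩
      simp only [hTs v hv w hw]
      rw [inv_mul_cancel_left₀ htc]
    -- The test function is the dilate of the function that is to vanish.
    set f := dil r u with hf
    have hfd : f ∈ maxDomain k T := hdom huhol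
    have hfB : f ∈ Bergman n k := hfd.1
    have e1 : innerProd k (T f) (dil r g) = t * innerProd k f (dil r (S g)) := by
      rw [hadj f hfd (dil r g) (hB hg.1) _ (mul_mem_bergman (t : ℂ) (hB hSg))
        (fun w hw => hSs g hg.1 w hw), innerProd_smul_right]
    have e2 : innerProd k (T f) (dil r g) = t * innerProd k f (dil r h) := by
      rw [← innerProd_dil hfd.2 hg h0.le h1,
        innerProd_congr k (fun w hw => hTs f hfB.1 w hw) (Set.eqOn_refl g _),
        innerProd_smul_left, H _ (hdom hfB.1), innerProd_dil hfB hh h0.le h1]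
    have e3 := mul_left_cancel₀ htc (e1.symm.trans e2)
    refine eqOn_zero_of_innerProd_self hJ hfB ?_
    have i1 := integrableOn_conj_mul_weight hfB (hB hSg)
    have i2 := integrableOn_conj_mul_weight hfB (hB hh.1)
    have e4 : innerProd k f f = innerProd k f (dil r (S g)) - innerProd k f (dil r h) := by
      rw [innerProd, innerProd, innerProd, ← mul_sub, ← integral_sub i1 i2]
      congr 2
      funext w
      simp only [hf, hu, dil]
      ring
    rw [e4, e3, sub_self]
  -- Every point of the ball is `r` times a point of the ball, for some `r < 1`.
  intro w hw
  have hw1 := mem_ball_iff.1 hw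
  obtain ⟨r, hr1, hr2⟩ := exists_between hw1
  have hr0 : 0 < r := (norm_nonneg _).trans_lt hr1
  have hrc : (r : ℂ) ≠ 0 := by exact_mod_cast hr0.ne'
  have hv : (r : ℂ)⁻¹ • w ∈ ball n := by
    rw [mem_ball_iff, map_smul, norm_smul, norm_inv, Complex.norm_real, Real.norm_of_nonneg hr0.le,
      inv_mul_lt_iff₀ hr0, mul_one]
    exact hr1
  have h2 := key r hr0 hr2 hv
  simp only [dil, smul_smul, mul_inv_cancel₀ hrc, one_smul, hu, Pi.zero_apply] at h2
  exact (sub_eq_zero.1 h2).symm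

lemma fderiv_dil {n : ℕ} {u : Coord n → ℂ} (hu : IsHol u) {r : ℝ} (h0 : 0 ≤ r) (h1 : r ≤ 1)
    {w : Coord n} (hw : w ∈ ball n) (V : Coord n) :
    fderiv ℂ (dil r u) w V = r * fderiv ℂ u ((r : ℂ) • w) V := by
  have h := (differentiableAt_of_isHol hu (smul_mem_ball (norm_ofReal_le h0 h1) hw)).hasFDerivAt
  have h2 : HasFDerivAt (dil r u) _ w :=
    h.comp w ((r : ℂ) • ContinuousLinearMap.id ℂ (Coord n)).hasFDerivAt
  rw [h2.fderiv]
  simp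

lemma dil_diffOp {n : ℕ} {α : Coord n → ℂ} {X : Coord n → Coord n} {t r : ℝ} (h0 : 0 ≤ r)
    (h1 : r ≤ 1) {w : Coord n} (hw : w ∈ ball n) (hα : α ((r : ℂ) • w) = t * α w)
    (hX : X ((r : ℂ) • w) = ((t : ℂ) * r) • X w) {u : Coord n → ℂ} (hu : IsHol u) :
    dil r (diffOp α X u) w = t * diffOp α X (dil r u) w := by
  change diffOp α X u ((r : ℂ) • w) = _
  simp only [diffOp]
  rw [fderiv_dil hu h0 h1 hw, hα, hX]
  simp only [dil, map_smul, smul_eq_mul]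
  ring

lemma dil_Kminus {n : ℕ} {r : ℝ} (h0 : 0 < r) (h1 : r ≤ 1) (a b : Fin n) {u : Coord n → ℂ}
    (hu : IsHol u) {w : Coord n} (hw : w ∈ ball n) :
    r * dil r (Kminus a b u) w = Kminus a b (dil r u) w := by
  have hrc : (r : ℂ) ≠ 0 := by exact_mod_cast h0.ne'
  rw [Kminus_eq_diffOp, dil_diffOp (t := r⁻¹) h0.le h1 hw (by simp) (by simp [hrc]) hu]
  push_cast
  rw [mul_inv_cancel_left₀ hrc]

lemma dil_Kzero {n : ℕ} (k : ℝ) {r : ℝ} (h0 : 0 < r) (h1 : r ≤ 1) (a b : Fin n)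
    {u : Coord n → ℂ} (hu : IsHol u) {w : Coord n} (hw : w ∈ ball n) :
    dil r (Kzero (fun _ => k) a b u) w = Kzero (fun _ => k) a b (dil r u) w := by
  rw [Kzero_eq_diffOp, dil_diffOp (t := 1) h0.le h1 hw (by simp) ?_ hu]
  · simp
  · have : mat ((r : ℂ) • w) a = (r : ℂ) • mat w a := rfl
    simp only [this, map_smul, LinearMap.smul_apply, Complex.ofReal_one, one_mul]

lemma dil_Kplus {n : ℕ} (k : ℝ) {r : ℝ} (h0 : 0 < r) (h1 : r ≤ 1) (a b : Fin n)
    {u : Coord n → ℂ} (hu : IsHol u) {w : Coord n} (hw : w ∈ ball n) :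
    dil r (Kplus (fun _ => k) a b u) w = r * Kplus (fun _ => k) a b (dil r u) w := by
  rw [Kplus_eq_diffOp, dil_diffOp (t := r) h0.le h1 hw ?_ ?_ hu]
  · rw [mat_smul, Matrix.smul_apply, smul_eq_mul]; ring
  · have : ∀ c, mat ((r : ℂ) • w) c = (r : ℂ) • mat w c := fun _ => rfl
    simp only [this, map_smul, LinearMap.smul_apply, smul_smul]

lemma hasAdjoint_Kplus {n : ℕ} {k : ℝ} (hint : IntegrableOn (weight (n := n) k) (ball n))
    (hJ : huaJ n (expo n k) ≠ 0) (a b : Fin n) :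
    HasAdjoint k (Kplus (fun _ => k) a b) (Kminus a b) :=
  hasAdjoint_of_scaleInversely hint hJ (preservesHol_Kplus k a b) (preservesHol_Kminus a b)
    (fun r h0 h1 => ⟨r, h0.ne', fun _ hu _ hw => dil_Kplus k h0 h1.le a b hu hw,
      fun _ hu _ hw => dil_Kminus h0 h1.le a b hu hw⟩)
    fun _ hf _ hg _ hu hug => innerProd_Kplus a b hf hg hu hug

lemma hasAdjoint_Kzero {n : ℕ} {k : ℝ} (hint : IntegrableOn (weight (n := n) k) (ball n))
    (hJ : huaJ n (expo n k) ≠ 0) (a b : Fin n) :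
    HasAdjoint k (Kzero (fun _ => k) a b) (Kzero (fun _ => k) b a) :=
  hasAdjoint_of_scaleInversely hint hJ (preservesHol_Kzero k a b) (preservesHol_Kzero k b a)
    (fun r h0 h1 => ⟨1, one_ne_zero, fun _ hu _ hw => by
      rw [dil_Kzero k h0 h1.le a b hu hw, Complex.ofReal_one, one_mul],
      fun _ hu _ hw => by
        rw [dil_Kzero k h0 h1.le b a hu hw, Complex.ofReal_one, one_mul]⟩)
    fun _ hf _ hg _ hu hug => innerProd_Kzero a b hf hg hu hug

/-! ### The determinant along the last diagonal coordinate -/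

lemma updateRow_swap {ι : Type*} [DecidableEq ι] (N : Matrix ι ι ℂ) {i j : ι} (hij : i ≠ j)
    (x y : ι → ℂ) :
    (N.updateRow i x).updateRow j y = (N.updateRow j y).updateRow i x := by
  ext a b
  by_cases ha : a = i
  · subst ha; simp [updateRow_apply, hij]
  · by_cases hb : a = j
    · subst hb; simp [updateRow_apply, ha]
    · simp [updateRow_apply, ha, hb]

lemma det_update_two_rows {ι : Type*} [DecidableEq ι] [Fintype ι] (N : Matrix ι ι ℂ) {i j : ι}
    (hij : i ≠ j) (x y : ι → ℂ) (s t : ℂ) :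
    ((N.updateRow i (N i + s • x)).updateRow j (N j + t • y)).det =
      N.det + s * (N.updateRow i x).det + t * (N.updateRow j y).det +
        s * t * ((N.updateRow i x).updateRow j y).det := by
  have h1 : ∀ v : ι → ℂ, (N.updateRow i v).updateRow j (N j) = N.updateRow i v := by
    intro v
    rw [updateRow_swap N hij, updateRow_eq_self]
  rw [det_updateRow_add, det_updateRow_smul, h1, det_updateRow_add, det_updateRow_smul,
    updateRow_eq_self, updateRow_swap N hij, det_updateRow_add, det_updateRow_smul,
    updateRow_swap N hij x y]
  have h2 : (N.updateRow j y).updateRow i (N i) = N.updateRow j y := by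
    rw [← updateRow_swap N hij, updateRow_eq_self]
  rw [h2]
  ring

/-- The upper left corner of a symmetric matrix. -/
def corner {m : ℕ} (u : Coord (m + 1)) : Coord m := fun p => u (p.map Fin.castSucc)

/-- The symmetric matrix `u` with its last diagonal entry replaced by `z`. -/
noncomputable def setLast {m : ℕ} (u : Coord (m + 1)) (z : ℂ) : Coord (m + 1) :=
  Function.update u s(Fin.last m, Fin.last m) z

lemma mat_setLast_last {m : ℕ} (u : Coord (m + 1)) (z : ℂ) :
    mat (setLast u z) (Fin.last m) (Fin.last m) = z := by
  simp [mat, setLast]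

lemma mat_setLast_of_ne {m : ℕ} (u : Coord (m + 1)) (z : ℂ) {i j : Fin (m + 1)}
    (h : ¬(i = Fin.last m ∧ j = Fin.last m)) : mat (setLast u z) i j = mat u i j := by
  have : s(i, j) ≠ s(Fin.last m, Fin.last m) := by
    intro hs
    rw [Sym2.eq_iff] at hs
    rcases hs with hs | hs
    · exact h hs
    · exact h hs
  simp [mat, setLast, this]

lemma mat_corner {m : ℕ} (u : Coord (m + 1)) (i j : Fin m) :
    mat (corner u) i j = mat u i.castSucc j.castSucc := rfl

lemma corner_setLast {m : ℕ} (u : Coord (m + 1)) (z : ℂ) : corner (setLast u z) = corner u := by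
  refine coord_ext fun p q => ?_
  rw [mat_corner, mat_setLast_of_ne, mat_corner]
  exact fun h => (Fin.castSucc_lt_last p).ne h.1

/-- The block matrix with determinant `det (1 - W W̄)`. -/
noncomputable def blockMat {m : ℕ} (u : Coord m) : Matrix (Fin m ⊕ Fin m) (Fin m ⊕ Fin m) ℂ :=
  fromBlocks 1 ((mat u).map (starRingEnd ℂ)) (mat u) 1

lemma det_blockMat {m : ℕ} (u : Coord m) : (blockMat u).det = (gap u).det := by
  rw [blockMat, det_fromBlocks_one₁₁]
  rfl

lemma blockMat_setLast {m : ℕ} (u : Coord (m + 1)) (z : ℂ) :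
    blockMat (setLast u z) =
      (((blockMat (setLast u 0)).updateRow (Sum.inl (Fin.last m))
        (blockMat (setLast u 0) (Sum.inl (Fin.last m)) +
          starRingEnd ℂ z • Pi.single (Sum.inr (Fin.last m)) 1)).updateRow (Sum.inr (Fin.last m))
        (blockMat (setLast u 0) (Sum.inr (Fin.last m)) +
          z • Pi.single (Sum.inl (Fin.last m)) 1)) := by
  have h : ∀ i j, mat (setLast u z) i j = mat (setLast u 0) i j +
      if i = Fin.last m ∧ j = Fin.last m then z else 0 := by
    intro i j
    by_cases hij : i = Fin.last m ∧ j = Fin.last m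
    · obtain ⟨rfl, rfl⟩ := hij
      simp [mat_setLast_last]
    · simp [mat_setLast_of_ne u _ hij, hij]
  ext a b
  rcases a with i | i <;> rcases b with j | j
  · by_cases hi : i = Fin.last m <;> simp [blockMat, updateRow_apply, hi]
  · by_cases hi : i = Fin.last m <;> by_cases hj : j = Fin.last m <;>
      simp [blockMat, updateRow_apply, hi, hj, h, mat_setLast_last]
  · by_cases hi : i = Fin.last m <;> by_cases hj : j = Fin.last m <;>
      simp [blockMat, updateRow_apply, hi, hj, h, mat_setLast_last]
  · by_cases hi : i = Fin.last m <;> simp [blockMat, updateRow_apply, hi]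

/-- Replacing both distinguished rows of the block matrix by unit vectors deletes the last row
and column of `W`. -/
lemma det_blockMat_unit_rows {m : ℕ} (u : Coord (m + 1)) :
    (((blockMat u).updateRow (Sum.inl (Fin.last m)) (Pi.single (Sum.inr (Fin.last m)) 1)).updateRow
      (Sum.inr (Fin.last m)) (Pi.single (Sum.inl (Fin.last m)) 1)).det =
      -(gap (corner u)).det := by
  set l := Fin.last m
  set B : Matrix (Fin (m + 1)) (Fin (m + 1)) ℂ := ((mat u).map (starRingEnd ℂ)).updateRow l 0
    with hB
  set C : Matrix (Fin (m + 1)) (Fin (m + 1)) ℂ := (mat u).updateRow l 0 with hC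
  have h1 : ((blockMat u).updateRow (Sum.inl l) (Pi.single (Sum.inr l) 1)).updateRow
      (Sum.inr l) (Pi.single (Sum.inl l) 1) =
      (fromBlocks 1 B C 1).submatrix (Equiv.swap (Sum.inl l) (Sum.inr l)) id := by
    ext a b
    rcases a with i | i <;> rcases b with j | j <;> by_cases hi : i = l
    all_goals
      first
      | (subst hi; simp [blockMat, updateRow_apply, Pi.single_apply, Matrix.one_apply, hB, hC,
          eq_comm])
      | (have e1 : Equiv.swap (Sum.inl l : Fin (m + 1) ⊕ Fin (m + 1)) (Sum.inr l) (Sum.inl i) =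
            Sum.inl i := Equiv.swap_apply_of_ne_of_ne (by simpa using hi) (by simp)
         simp [blockMat, updateRow_apply, hB, hC, hi, e1]; done)
      | (have e1 : Equiv.swap (Sum.inl l : Fin (m + 1) ⊕ Fin (m + 1)) (Sum.inr l) (Sum.inr i) =
            Sum.inr i := Equiv.swap_apply_of_ne_of_ne (by simp) (by simpa using hi)
         simp [blockMat, updateRow_apply, hB, hC, hi, e1])
  have h2 : (1 - C * B).det = (gap (corner u)).det := by
    have hrow : ∀ j, (1 - C * B) l j = (1 : Matrix (Fin (m + 1)) (Fin (m + 1)) ℂ) l j := by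
      intro j
      simp [Matrix.mul_apply, hC]
    have hsub : (1 - C * B).submatrix Fin.castSucc Fin.castSucc = gap (corner u) := by
      ext i j
      have hi : i.castSucc ≠ l := (Fin.castSucc_lt_last i).ne
      have hk : ∀ k : Fin m, k.castSucc ≠ l := fun k => (Fin.castSucc_lt_last k).ne
      simp only [submatrix_apply, Matrix.sub_apply, Matrix.mul_apply, Fin.sum_univ_castSucc, gap]
      congr 1
      · simp [Matrix.one_apply]
      · simp [hB, hC, updateRow_apply, hk, mat_corner, l]
    rw [det_succ_row _ l, Finset.sum_eq_single l]
    · rw [hrow, Matrix.one_apply_eq, ← hsub]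
      have hs : (l : ℕ) + (l : ℕ) = 2 * m := by simp [l]; ring
      rw [hs, pow_mul]
      simp [l, Fin.succAbove_last]
    · intro j _ hj
      rw [hrow, Matrix.one_apply_ne hj.symm]
      simp
    · simp
  rw [h1, det_permute, Equiv.Perm.sign_swap (by simp), det_fromBlocks_one₁₁, h2]
  simp

/-- As a function of the last diagonal coordinate `z`, the determinant of `1 - W W̄` is a real
quadratic polynomial in `z, z̄` whose leading coefficient is minus the determinant for the
corner. -/
lemma det_gap_setLast {m : ℕ} (u : Coord (m + 1)) :
    ∃ (a : ℝ) (β : ℂ), ∀ z : ℂ, (gap (setLast u z)).det.re =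
      a + (β * z).re - (gap (corner u)).det.re * ‖z‖ ^ 2 := by
  set N := blockMat (setLast u 0)
  refine ⟨N.det.re, starRingEnd ℂ (N.updateRow (Sum.inl (Fin.last m))
    (Pi.single (Sum.inr (Fin.last m)) 1)).det + (N.updateRow (Sum.inr (Fin.last m))
    (Pi.single (Sum.inl (Fin.last m)) 1)).det, fun z => ?_⟩
  rw [← det_blockMat, blockMat_setLast, det_update_two_rows _ (by simp), det_blockMat_unit_rows,
    corner_setLast]
  set x := (N.updateRow (Sum.inl (Fin.last m)) (Pi.single (Sum.inr (Fin.last m)) 1)).det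
  set y := (N.updateRow (Sum.inr (Fin.last m)) (Pi.single (Sum.inl (Fin.last m)) 1)).det
  have h1 : starRingEnd ℂ z * z = ((‖z‖ ^ 2 : ℝ) : ℂ) := by
    rw [Complex.conj_mul']; push_cast; rfl
  rw [h1, det_gap_eq_re (corner u)]
  rw [← Complex.ofReal_neg, ← Complex.ofReal_mul]
  simp only [Complex.add_re, Complex.mul_re, Complex.ofReal_re, Complex.add_im, Complex.conj_re,
    Complex.conj_im]
  ring

/-! ### Integrability of the weight -/

lemma lintegral_rpow_Ioo_lt_top {q : ℝ} (hq : -1 < q) :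
    ∫⁻ s : ℝ, (Set.Ioo (0 : ℝ) 1).indicator (fun s => ENNReal.ofReal (s ^ q)) s < ⊤ := by
  rw [lintegral_indicator measurableSet_Ioo]
  have h : IntegrableOn (fun s : ℝ => s ^ q) (Set.Ioo 0 1) :=
    (intervalIntegral.integrableOn_Ioo_rpow_iff zero_lt_one).2 hq
  exact h.lintegral_lt_top

/-- The function `(ρ - |z|²) ^ q` on the disc `|z|² < ρ`, extended by zero. -/
noncomputable def discPow (q ρ : ℝ) (z : ℂ) : ℝ≥0∞ :=
  {z : ℂ | ‖z‖ ^ 2 < ρ}.indicator (fun z => ENNReal.ofReal ((ρ - ‖z‖ ^ 2) ^ q)) z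

lemma mul_discPow_polar_le {q ρ : ℝ} (hq : -1 < q) (hq' : q < 0) (hρ : ρ ≤ 1) {r : ℝ} (hr : 0 < r)
    {z : ℂ} (hz : ‖z‖ = r) :
    ENNReal.ofReal r * discPow q ρ z ≤
      (Set.Ioo (0 : ℝ) 1).indicator (fun s => ENNReal.ofReal (s ^ q)) (√ρ - r) := by
  unfold discPow
  by_cases hzρ : ‖z‖ ^ 2 < ρ
  · rw [Set.indicator_of_mem (show z ∈ {z : ℂ | ‖z‖ ^ 2 < ρ} from hzρ), hz]
    rw [hz] at hzρ
    have hρ0 : 0 < ρ := (sq_nonneg r).trans_lt hzρ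
    have hR : r < √ρ := Real.lt_sqrt_of_sq_lt hzρ
    have hR1 : √ρ ≤ 1 := Real.sqrt_le_one.2 hρ
    have hs : 0 < √ρ - r := sub_pos.2 hR
    rw [Set.indicator_of_mem (show √ρ - r ∈ Set.Ioo (0 : ℝ) 1 from ⟨hs, by linarith⟩),
      ← ENNReal.ofReal_mul hr.le]
    refine ENNReal.ofReal_le_ofReal ?_
    have hfac : ρ - r ^ 2 = (√ρ + r) * (√ρ - r) := by
      nlinarith [Real.sq_sqrt hρ0.le]
    rw [hfac, Real.mul_rpow (by positivity) hs.le, ← mul_assoc]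
    refine mul_le_of_le_one_left (by positivity) ?_
    calc r * (√ρ + r) ^ q ≤ r * r ^ q := by
          refine mul_le_mul_of_nonneg_left ?_ hr.le
          exact Real.rpow_le_rpow_of_nonpos hr (by linarith) hq'.le
      _ = r ^ (1 + q) := by rw [Real.rpow_add hr, Real.rpow_one]
      _ ≤ 1 := Real.rpow_le_one hr.le (by linarith) (by linarith)
  · rw [Set.indicator_of_notMem (show z ∉ {z : ℂ | ‖z‖ ^ 2 < ρ} from hzρ)]
    simp

/-- The integral of `(ρ - |z - z₀|²) ^ q` over the disc `|z - z₀|² < ρ` is bounded uniformly for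
`ρ ≤ 1`. -/
lemma exists_lintegral_discPow_le {q : ℝ} (hq : -1 < q) (hq' : q < 0) :
    ∃ K : ℝ≥0∞, K < ⊤ ∧ ∀ ρ ≤ 1, ∀ z₀ : ℂ, ∫⁻ z, discPow q ρ (z - z₀) ≤ K := by
  set g : ℝ → ℝ≥0∞ := (Set.Ioo (0 : ℝ) 1).indicator (fun s => ENNReal.ofReal (s ^ q)) with hg
  have hgm : Measurable g :=
    (Measurable.ennreal_ofReal (by fun_prop)).indicator measurableSet_Ioo
  refine ⟨(∫⁻ s, g s) * volume (Set.Ioo (-Real.pi) Real.pi),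
    ENNReal.mul_lt_top (lintegral_rpow_Ioo_lt_top hq) (by simp), fun ρ hρ z₀ => ?_⟩
  rw [lintegral_sub_right_eq_self, ← Complex.lintegral_comp_polarCoord_symm]
  calc ∫⁻ p in polarCoord.target, ENNReal.ofReal p.1 • discPow q ρ (Complex.polarCoord.symm p)
      ≤ ∫⁻ p in polarCoord.target, g (√ρ - p.1) := by
        refine setLIntegral_mono' polarCoord.open_target.measurableSet fun p hp => ?_
        have hp1 : 0 < p.1 := by simpa using hp.1
        exact mul_discPow_polar_le hq hq' hρ hp1 (by simp [abs_of_pos hp1])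
    _ ≤ ∫⁻ p in Set.univ ×ˢ Set.Ioo (-Real.pi) Real.pi, g (√ρ - p.1) := by
        refine lintegral_mono_set ?_
        rw [polarCoord_target]
        exact Set.prod_mono (Set.subset_univ _) subset_rfl
    _ = (∫⁻ s, g s) * volume (Set.Ioo (-Real.pi) Real.pi) := by
        rw [Measure.volume_eq_prod, ← Measure.prod_restrict, Measure.restrict_univ]
        have := lintegral_prod_mul (μ := (volume : Measure ℝ))
          (ν := (volume : Measure ℝ).restrict (Set.Ioo (-Real.pi) Real.pi))
          (f := fun r => g (√ρ - r)) (g := fun _ => 1)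
          (hgm.comp (by fun_prop)).aemeasurable aemeasurable_const
        simp only [mul_one, lintegral_const, one_mul, Measure.restrict_apply_univ] at this
        rw [this, lintegral_sub_left_eq_self]

lemma corner_mem_ball {m : ℕ} {u : Coord (m + 1)} (hu : u ∈ ball (m + 1)) :
    corner u ∈ ball m := by
  have h : gap (corner u) = (gap u).submatrix Fin.castSucc Fin.castSucc +
      vecMulVec (fun i : Fin m => mat u i.castSucc (Fin.last m))
        (star fun i : Fin m => mat u i.castSucc (Fin.last m)) := by
    ext i j
    simp only [gap, Matrix.sub_apply, Matrix.mul_apply, Matrix.add_apply, submatrix_apply,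
      Fin.sum_univ_castSucc, vecMulVec_apply, mat_corner, Matrix.map_apply, Pi.star_apply]
    rw [mat_symm u (Fin.last m) j.castSucc]
    simp [Matrix.one_apply, sub_add]
  change (gap (corner u)).PosDef
  rw [h]
  exact (PosDef.submatrix (show (gap u).PosDef from hu)
    (Fin.castSucc_injective m)).add_posSemidef (posSemidef_vecMulVec_self_star _)

lemma continuous_setLast {m : ℕ} (u : Coord (m + 1)) : Continuous (setLast u) :=
  continuous_const.update _ continuous_id

/-- A slice of the Siegel ball in the last diagonal coordinate is contained in a disc of radius at
most one, on which the determinant is a multiple of the squared distance from the boundary. -/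
lemma det_gap_slice {m : ℕ} (u : Coord (m + 1)) {z₁ : ℂ} (h₁ : setLast u z₁ ∈ ball (m + 1)) :
    ∃ ρ ≤ (1 : ℝ), ∃ z₀ : ℂ, ∀ z, (gap (setLast u z)).det.re =
      (gap (corner u)).det.re * (ρ - ‖z - z₀‖ ^ 2) := by
  obtain ⟨a, β, hD⟩ := det_gap_setLast u
  have hc : 0 < (gap (corner u)).det.re := by
    have := det_gap_pos (corner_mem_ball h₁)
    rwa [corner_setLast] at this
  set c := (gap (corner u)).det.re
  set z₀ : ℂ := starRingEnd ℂ β / (2 * c : ℝ) with hz₀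
  set ρ : ℝ := a / c + ‖z₀‖ ^ 2 with hρ
  have hsq : ∀ z, (gap (setLast u z)).det.re = c * (ρ - ‖z - z₀‖ ^ 2) := by
    intro z
    have hβ : β = starRingEnd ℂ z₀ * (2 * c : ℝ) := by
      rw [hz₀, map_div₀, Complex.conj_conj, Complex.conj_ofReal, div_mul_cancel₀]
      exact_mod_cast (by positivity : (2 * c) ≠ 0)
    have h2 : (β * z).re = 2 * c * (z * starRingEnd ℂ z₀).re := by
      rw [hβ]
      simp only [Complex.mul_re, Complex.mul_im, Complex.ofReal_re, Complex.ofReal_im,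
        Complex.conj_re, Complex.conj_im]
      ring
    have h3 : ‖z - z₀‖ ^ 2 = ‖z‖ ^ 2 + ‖z₀‖ ^ 2 - 2 * (z * starRingEnd ℂ z₀).re := by
      simp only [← Complex.normSq_eq_norm_sq]
      exact Complex.normSq_sub z z₀
    rw [hD, h2, h3, hρ]
    field_simp
    ring
  refine ⟨ρ, ?_, z₀, hsq⟩
  have hpos : ∀ z, ‖z - z₀‖ ^ 2 < ρ ↔ 0 < (gap (setLast u z)).det.re := by
    intro z
    rw [hsq, mul_pos_iff_of_pos_left hc, sub_pos]
  have hdisc : {z : ℂ | ‖z - z₀‖ ^ 2 < ρ} = Metric.ball z₀ (√ρ) := by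
    ext z
    rw [Metric.mem_ball, dist_eq_norm, Real.lt_sqrt (norm_nonneg _)]
    rfl
  -- The disc is connected and meets the ball, and it cannot cross the boundary of the ball, where
  -- the determinant vanishes.
  have hsub : {z : ℂ | ‖z - z₀‖ ^ 2 < ρ} ⊆ {z | ‖opr (setLast u z)‖ < 1} := by
    have hcont : Continuous fun z => ‖opr (setLast u z)‖ :=
      (continuous_opr.comp (continuous_setLast u)).norm
    refine IsPreconnected.subset_left_of_subset_union (v := {z | 1 < ‖opr (setLast u z)‖})
      (isOpen_lt hcont continuous_const) (isOpen_lt continuous_const hcont) ?_ ?_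
      ⟨z₁, (hpos z₁).2 (det_gap_pos h₁), mem_ball_iff.1 h₁⟩ ?_
    · rw [Set.disjoint_left]
      intro z hz hz'
      change ‖opr (setLast u z)‖ < 1 at hz
      exact hz.asymm hz'
    · intro z hz
      rcases lt_trichotomy ‖opr (setLast u z)‖ 1 with h | h | h
      · exact Or.inl h
      · refine Or.inl (mem_ball_iff.1 (mem_ball_of_det_ne_zero h.le fun h0 => ?_))
        have := (hpos z).1 hz
        rw [h0] at this
        simp at this
      · exact Or.inr h
    · rw [hdisc]
      exact (convex_ball _ _).isPreconnected
  have hone : ∀ z : ℂ, ‖z - z₀‖ ^ 2 < ρ → ‖z‖ ≤ 1 := by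
    intro z hz
    have := norm_apply_le_one (mem_ball_iff.2 (hsub hz)) s(Fin.last m, Fin.last m)
    simpa [setLast] using this
  -- A disc of radius larger than one does not fit into the closed unit disc.
  by_contra! hlt
  set t : ℝ := √((1 + ρ) / 2)
  have ht : t ^ 2 = (1 + ρ) / 2 := Real.sq_sqrt (by linarith)
  have ht0 : 0 ≤ t := Real.sqrt_nonneg _
  have e1 := hone (z₀ + t) (by simp; linarith)
  have e2 := hone (z₀ - t) (by simp; linarith)
  have e3 : ‖(z₀ + t) - (z₀ - t)‖ = 2 * t := by
    rw [show (z₀ + t) - (z₀ - t) = ((2 * t : ℝ) : ℂ) by push_cast; ring, Complex.norm_real,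
      Real.norm_of_nonneg (by positivity)]
  have e4 := norm_sub_le (z₀ + (t : ℂ)) (z₀ - t)
  nlinarith

/-- The function `det (1 - W W̄) ^ q` on the Siegel ball, extended by zero. -/
noncomputable def powDet {m : ℕ} (q : ℝ) (u : Coord m) : ℝ≥0∞ :=
  (ball m).indicator (fun u => ENNReal.ofReal ((gap u).det.re ^ q)) u

lemma measurable_powDet {m : ℕ} (q : ℝ) : Measurable (powDet q : Coord m → ℝ≥0∞) :=
  ((continuous_det_gap.measurable.pow_const q).ennreal_ofReal).indicator isOpen_ball.measurableSet

/-- Integrating out the last diagonal coordinate bounds the weight by that of the corner, up to a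
constant that depends on the exponent only. -/
lemma exists_lintegral_powDet_setLast_le {q : ℝ} (hq : -1 < q) (hq' : q < 0) :
    ∃ K : ℝ≥0∞, K < ⊤ ∧ ∀ (m : ℕ) (u : Coord (m + 1)),
      ∫⁻ z, powDet q (setLast u z) ≤ K * powDet q (corner u) := by
  obtain ⟨K, hK, hle⟩ := exists_lintegral_discPow_le hq hq'
  refine ⟨K, hK, fun m u => ?_⟩
  by_cases h : ∃ z₁, setLast u z₁ ∈ ball (m + 1)
  · obtain ⟨z₁, h₁⟩ := h
    obtain ⟨ρ, hρ, z₀, hD⟩ := det_gap_slice u h₁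
    have hcor : corner u ∈ ball m := by
      have := corner_mem_ball h₁
      rwa [corner_setLast] at this
    have hc := det_gap_pos hcor
    rw [mul_comm]
    refine le_trans ?_ (mul_le_mul_right (hle ρ hρ z₀) _)
    rw [← lintegral_const_mul' _ _ (by simp [powDet, hcor])]
    refine lintegral_mono fun z => ?_
    by_cases hz : setLast u z ∈ ball (m + 1)
    · have hpos := det_gap_pos hz
      rw [hD, mul_pos_iff_of_pos_left hc] at hpos
      rw [powDet, Set.indicator_of_mem hz, hD, powDet, Set.indicator_of_mem hcor, discPow,
        Set.indicator_of_mem (show z - z₀ ∈ {z : ℂ | ‖z‖ ^ 2 < ρ} from sub_pos.1 hpos),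
        ← ENNReal.ofReal_mul (by positivity), Real.mul_rpow hc.le hpos.le]
    · rw [powDet, Set.indicator_of_notMem hz]
      exact zero_le
  · rw [lintegral_congr (g := fun _ => 0), lintegral_zero]
    · exact zero_le
    · intro z
      rw [powDet, Set.indicator_of_notMem]
      exact fun hz => h ⟨z, hz⟩

/-- The upper left `m × m` block of a symmetric `n × n` matrix. -/
def block {m n : ℕ} (h : m ≤ n) (w : Coord n) : Coord m := fun p => w (p.map (Fin.castLE h))

lemma measurable_block {m n : ℕ} (h : m ≤ n) : Measurable (block h) :=
  measurable_pi_lambda _ fun _ => measurable_pi_apply _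

lemma corner_block {m n : ℕ} (h : m + 1 ≤ n) (w : Coord n) :
    corner (block h w) = block (Nat.le_of_succ_le h) w := by
  funext p
  simp only [corner, block, Sym2.map_map]
  rfl

lemma block_update {m n : ℕ} (h : m + 1 ≤ n) (w : Coord n) (z : ℂ) :
    block h (Function.update w (s(Fin.last m, Fin.last m).map (Fin.castLE h)) z) =
      setLast (block h w) z :=
  Function.update_comp_eq_of_injective w (Sym2.map.injective (Fin.castLE_injective h)) _ z

/-- The Lebesgue measure on the closed unit polydisc. -/
noncomputable abbrev polydisc (n : ℕ) : Measure (Coord n) :=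
  Measure.pi fun _ => (volume : Measure ℂ).restrict (Metric.closedBall 0 1)

/-- Over the unit polydisc, the power of the determinant of each upper left block is integrable:
integrating out the last diagonal entry of the block leads to the next smaller block. -/
lemma lintegral_powDet_block_lt_top {n : ℕ} {q : ℝ} (hq : -1 < q) (hq' : q < 0) (m : ℕ) :
    ∀ h : m ≤ n, ∫⁻ w : Coord n, powDet q (block h w) ∂polydisc n < ⊤ := by
  obtain ⟨K, hK, hle⟩ := exists_lintegral_powDet_setLast_le hq hq'
  induction m with
  | zero =>
    intro h
    have hb : ∀ w : Coord n, powDet q (block h w) ≤ 1 := by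
      intro w
      refine (Set.indicator_le_self' (by simp) _).trans ?_
      simp
    calc ∫⁻ w : Coord n, powDet q (block h w) ∂polydisc n ≤ ∫⁻ w : Coord n, 1 ∂polydisc n :=
          lintegral_mono hb
      _ < ⊤ := by
          rw [lintegral_one, Measure.pi_univ]
          refine ENNReal.prod_lt_top fun i _ => ?_
          rw [Measure.restrict_apply_univ]
          exact measure_closedBall_lt_top
  | succ m ih =>
    intro h
    have h' := Nat.le_of_succ_le h
    set i₀ : Sym2 (Fin n) := s(Fin.last m, Fin.last m).map (Fin.castLE h) with hi₀
    have hm : ∀ {m : ℕ} (h : m ≤ n), Measurable fun w : Coord n => powDet q (block h w) :=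
      fun h => (measurable_powDet q).comp (measurable_block h)
    have hcor : ∀ (w : Coord n) (z : ℂ), block h' (Function.update w i₀ z) = block h' w := by
      intro w z
      rw [← corner_block h, block_update, corner_setLast, corner_block]
    have hstep : ∫⁻ w : Coord n, powDet q (block h w) ∂polydisc n ≤
        ∫⁻ w : Coord n, K * powDet q (block h' w) ∂polydisc n := by
      refine lintegral_le_of_lmarginal_le {i₀} (hm h) ((hm h').const_mul K) fun w => ?_
      rw [lmarginal_singleton, lmarginal_singleton]
      simp only [hcor]
      simp only [hi₀, block_update]
      rw [lintegral_const, Measure.restrict_apply_univ]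
      calc ∫⁻ z in Metric.closedBall 0 1, powDet q (setLast (block h w) z)
          ≤ ∫⁻ z, powDet q (setLast (block h w) z) := setLIntegral_le_lintegral _ _
        _ ≤ K * powDet q (block h' w) := by rw [← corner_block h]; exact hle m _
        _ ≤ K * powDet q (block h' w) * volume (Metric.closedBall (0 : ℂ) 1) := by
            -- The unit disc has area `π ≥ 1`.
            refine le_mul_of_one_le_right zero_le ?_
            rw [Complex.volume_closedBall]
            simp only [ENNReal.ofReal_one, one_pow, one_mul]
            exact_mod_cast NNReal.coe_le_coe.1 (by simpa using (by linarith [Real.pi_gt_three]))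
    refine hstep.trans_lt ?_
    rw [lintegral_const_mul _ (hm h')]
    exact ENNReal.mul_lt_top hK (ih h')

/-- The weight is integrable over the Siegel ball when its exponent exceeds `-1`. -/
lemma integrableOn_weight {n : ℕ} {k : ℝ} (h : -1 < expo n k) :
    IntegrableOn (weight k : Coord n → ℝ) (ball n) := by
  have hmeas : AEStronglyMeasurable (weight k : Coord n → ℝ) (volume.restrict (ball n)) :=
    (continuous_det_gap.measurable.pow_const _).aestronglyMeasurable
  rcases le_or_gt 0 (expo n k) with h0 | h0
  · have hcont : Continuous (weight k : Coord n → ℝ) :=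
      continuous_det_gap.rpow_const fun _ => Or.inr h0
    refine (hcont.continuousOn.integrableOn_compact (isCompact_opr_le 1)).mono_set fun w hw => ?_
    exact (mem_ball_iff.1 hw).le
  · refine ⟨hmeas, ?_⟩
    rw [hasFiniteIntegral_iff_ofReal]
    · have hid : ∀ w : Coord n, block le_rfl w = w := fun w => coord_ext fun _ _ => rfl
      have hfin := lintegral_powDet_block_lt_top (n := n) h h0 n le_rfl
      simp only [hid] at hfin
      rw [polydisc, ← Measure.restrict_pi_pi] at hfin
      refine lt_of_le_of_lt ?_ hfin
      calc ∫⁻ w in ball n, ENNReal.ofReal (weight k w)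
          = ∫⁻ w in ball n, powDet (expo n k) w :=
            setLIntegral_congr_fun isOpen_ball.measurableSet fun w hw => by
              simp [powDet, hw, weight]
        _ ≤ _ := by
            refine lintegral_mono_set fun w hw => Set.mem_univ_pi.2 fun p => ?_
            simpa using norm_apply_le_one hw p
    · filter_upwards [ae_restrict_mem isOpen_ball.measurableSet] with w hw
      exact (weight_pos k hw).le

end SiegelBall

open SiegelBall

theorem lemma4p2 (n : ℕ) (k : ℝ) :
    -- the operators act on the holomorphic functions on the Siegel ball
    (∀ i j : Fin n, PreservesHol (Kzero (fun _ => k) i j) ∧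
      PreservesHol (Kminus (n := n) i j) ∧ PreservesHol (Kplus (fun _ => k) i j)) ∧
    -- the commutation relations
    (∀ i j a b : Fin n,
      HolEq (opComm (Kminus i j) (Kminus a b)) 0 ∧
      HolEq (opComm (Kplus (fun _ => k) i j) (Kplus (fun _ => k) a b)) 0 ∧
      HolEq ((2 : ℂ) • opComm (Kminus i j) (Kzero (fun _ => k) a b))
        (δ a j • Kminus i b + δ a i • Kminus j b) ∧
      HolEq ((2 : ℂ) • opComm (Kminus i j) (Kplus (fun _ => k) a b))
        (δ b i • Kzero (fun _ => k) a j + δ a i • Kzero (fun _ => k) b j +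
          δ b j • Kzero (fun _ => k) a i + δ a j • Kzero (fun _ => k) b i) ∧
      HolEq ((2 : ℂ) • opComm (Kplus (fun _ => k) i j) (Kzero (fun _ => k) a b))
        (-(δ j b • Kplus (fun _ => k) i a) - δ b i • Kplus (fun _ => k) j a) ∧
      HolEq ((2 : ℂ) • opComm (Kzero (fun _ => k) j i) (Kzero (fun _ => k) a b))
        (δ a i • Kzero (fun _ => k) j b - δ b j • Kzero (fun _ => k) a i)) ∧
    -- the hermiticity properties, for `k/2 - n - 1 > -1`
    (-1 < expo n k → ∀ a b : Fin n,
      HasAdjoint k (Kplus (fun _ => k) a b) (Kminus b a) ∧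
      HolEq (Kminus (n := n) b a) (Kminus a b) ∧
      HasAdjoint k (Kzero (fun _ => k) a b) (Kzero (fun _ => k) b a)) := by
  refine ⟨fun i j => ⟨preservesHol_Kzero k i j, preservesHol_Kminus i j, preservesHol_Kplus k i j⟩,
    fun i j a b => ⟨opComm_Kminus_Kminus i j a b, opComm_Kplus_Kplus k i j a b,
      opComm_Kminus_Kzero k i j a b, opComm_Kminus_Kplus k i j a b, opComm_Kplus_Kzero k i j a b,
      opComm_Kzero_Kzero k i j a b⟩, fun hq a b => ⟨?_, ?_, ?_⟩⟩
  · rw [Kminus_swap]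
    exact hasAdjoint_Kplus (integrableOn_weight hq) (huaJ_ne_zero hq) a b
  · rw [Kminus_swap]
    exact fun _ _ => Set.eqOn_refl _ _
  · exact hasAdjoint_Kzero (integrableOn_weight hq) (huaJ_ne_zero hq) a b
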